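/- Let $\mathbf k$ be a field; all algebras, linear maps and unadorned tensor products are over $\mathbf k$. Let $R$ be a commutative unital algebra. Sweedler notation $\Delta(x)=x_1\otimes x_2$ is used. **Definitions.** A *post-Hopf algebra* $(A,\rhd)$ is a Hopf algebra $A$ with a coalgebra homomorphism $\rhd:A\otimes A\to A$ such that $x\rhd(yz)=(x_1\rhd y)(x_2\rhd z)$, $x\rhd(y\rhd z)=(x_1(x_2\rhd y))\rhd z$, and $\alpha:A\to\mathrm{End}(A)$, $\alpha_x(y)=x\rhd y$, has a (unique) convolution inverse $\beta$, i.e. $\alpha_{x_1}\beta_{x_2}=\beta_{x_1}\alpha_{x_2}=\varepsilon(x)\,\mathrm{id}$. If $A$ is cocommutative, its *sub-adjacent Hopf algebra* is $A_\rhd=(A,*_\rhd,1,\Delta,\varepsilon,S_\rhd)$ with $x*_\rhd y=x_1(x_2\rhd y)$ and $S_\rhd(x)=\beta_{x_1}(S(x_2))$. A *bialgebroid* over $R$ is a unital algebra $H$ with an algebra map $\iota:R\to H$ (making $H$ an $R$-module by $fx=\iota(f)x$), a coassociative $R$-linear $\Delta:H\to H\otimes_R H$ and an $R$-linear counit $\varepsilon:H\to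 R$ such that $\Delta(x)(\iota(f)\otimes1-1\otimes\iota(f))=0$, $\Delta(xy)=x_1y_1\otimes_R x_2y_2$, $\Delta(1)=1\otimes_R1$, $\varepsilon(1)=1$ and $\varepsilon(x(y-\iota\varepsilon(y)))=0$. It is a *Hopf algebroid* (in the sense of Lu) if it has an algebra anti-automorphism $S$ with $S\iota=\iota$, $m(S\otimes\mathrm{id})\Delta=\iota\varepsilon S$ and $m(\mathrm{id}\otimes S)\gamma\Delta=\iota\varepsilon$ for some $\mathbf k$-linear section $\gamma$ of the projection $H\otimes H\to H\otimes_R H$. A *post-Hopf algebroid* over $R$ is a cocommutative Hopf $R$-algebra $H$ (with $\iota:R\to H$ the structure map) with a linear map $\rhd:H\otimes H\to H$ such that $\Delta(x\rhd y)=(x_1\rhd y_1)\otimes_R(x_2\rhd y_2)$, $x\rhd1=\iota(\varepsilon(x))$, $1\rhd x=x$, $\iota(\varepsilon(x\rhd y))=x\rhd\iota(\varepsilon(y))$, $fx\rhd y=f(x\rhd y)$, $x\rhd yz=(x_1\rhd y)(x_2\rhd z)$, $x\rhd(y\rhd z)=x_1(x_2\rhd y)\rhd z$, and a linear bijection $\theta:H\to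 H$ that is a unital algebra anti-automorphism for the Grossman-Larson product $x*_\rhd y=x_1(x_2\rhd y)$ and satisfies $\Delta(\theta(x))=\theta(x_1)\otimes_R\theta(x_2)$, $x_1*_\rhd\theta(x_2)=\iota(\varepsilon(x))$ and $\theta(x_1)*_\rhd x_2=\iota(\varepsilon(\theta(x)))$. Here, in the first two identities for $\theta$ (whose right-hand, respectively left-hand, side is not well defined on $H\otimes_RH$), $x_1\otimes x_2$ stands for $\gamma(\Delta(x))$ for some $\mathbf k$-linear section $\gamma$ of $H\otimes H\to H\otimes_RH$, the same in both. **Theorem.** Let $(A,\rhd)$ be a cocommutative post-Hopf algebra, and let $R$ be a module algebra over $A_\rhd$ via $\rightharpoonup$, that is, $(x*_\rhd y)\rightharpoonup f=x\rightharpoonup(y\rightharpoonup f)$, $1\rightharpoonup f=f$, $x\rightharpoonup fg=(x_1\rightharpoonup f)(x_2\rightharpoonup g)$ and $x\rightharpoonup1=\varepsilon(x)1$. Write $fa$ for $f\otimes a\in R\otimes A$. Then $A_\rhd$ is a Hopf algebra with bijective antipode, and the tensor product Hopf $R$-algebra $H=R\otimes A$, with $\iota(f)=f1_A$, $\Delta_H(fa)=fa_1\otimes_R1_Ra_2$,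 $\varepsilon_H(fa)=f\varepsilon(a)$, $S_H(fa)=fS(a)$, has a post-Hopf algebroid structure $(\overline\rhd,\theta)$ over $R$ with $$fa\,\overline\rhd\,gb=f(a_1\rightharpoonup g)(a_2\rhd b),\qquad \theta(fa)=(S_\rhd(a_1)\rightharpoonup f)\,S_\rhd(a_2).$$ Moreover $\Delta_H(\theta(fga))=\theta(fa_1)\otimes_R\theta(ga_2)$ and $fa_1*_{\overline\rhd}\theta(ga_2)=\iota(fg\,\varepsilon(a))$ for all $f,g\in R$, $a\in A$. The tuple $H_{\overline\rhd}=(H,*_{\overline\rhd},1,\Delta_H,\varepsilon_H,\theta,\iota)$ is a Hopf algebroid over $R$ (the Grossman-Larson Hopf algebroid), and it is equal to the action Hopf algebroid $R\#A_\rhd$, whose product is $fa\cdot gb=f(a_1\rightharpoonup g)(a_2*_\rhd b)$, whose $\iota,\Delta,\varepsilon$ are given by the formulas above, and whose antipode is $fa\mapsto(S_\rhd(a_1)\rightharpoonup f)S_\rhd(a_2)$. -/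

import Mathlib

open scoped TensorProduct

namespace PostHopf

noncomputable section

/-- `t = ∑ i, u i ⊗ v i` in `M ⊗_R N`. Applied to `t = Δ(x)` this is a Sweedler presentation
`Δ(x) = x₁ ⊗_R x₂`. Below, an identity in Sweedler notation is required to hold for *every*
presentation of the coproducts that occur in it (so that it does not depend on the
presentation), except where a section of `H ⊗_k H → H ⊗_R H` is mentioned explicitly. -/
def Represents {R M N : Type*} [CommRing R] [AddCommGroup M] [AddCommGroup N]
    [Module R M] [Module R N] {n : ℕ} (t : M ⊗[R] N) (u : Fin n → M) (v : Fin n → N) : Prop :=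
  t = ∑ i, u i ⊗ₜ[R] v i

theorem exists_represents {R M N : Type*} [CommRing R] [AddCommGroup M] [AddCommGroup N]
    [Module R M] [Module R N] (t : M ⊗[R] N) :
    ∃ (n : ℕ) (u : Fin n → M) (v : Fin n → N), Represents t u v := by
  induction t with
  | zero => exact ⟨0, Fin.elim0, Fin.elim0, by simp [Represents]⟩
  | tmul x y => exact ⟨1, fun _ => x, fun _ => y, by simp [Represents]⟩
  | add s t hs ht =>
    obtain ⟨n, u, v, h⟩ := hs
    obtain ⟨m, u', v', h'⟩ := ht
    refine ⟨n + m, Fin.append u u', Fin.append v v', ?_⟩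
    simp only [Represents] at h h' ⊢
    simp [Fin.sum_univ_add, h, h']

/-- The canonical projection `H ⊗_k H → H ⊗_R H`. -/
def proj (k R H : Type*) [CommRing k] [CommRing R] [Algebra k R] [AddCommGroup H] [Module k H]
    [Module R H] [IsScalarTower k R H] : H ⊗[k] H →ₗ[k] H ⊗[R] H :=
  TensorProduct.mapOfCompatibleSMul R k k H H

/-- `γ` is a `k`-linear section of the canonical projection `H ⊗_k H → H ⊗_R H`. -/
def IsProjSection {k R H : Type*} [CommRing k] [CommRing R] [Algebra k R] [AddCommGroup H]
    [Module k H] [Module R H] [IsScalarTower k R H] (γ : H ⊗[R] H →ₗ[k] H ⊗[k] H) : Prop :=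
  ∀ t, proj k R H (γ t) = t

/-! ### Bialgebroids and Hopf algebroids over a commutative base -/

/-- The data `(H, ·, 1, Δ, ε, S, ι)` of a Hopf algebroid over the commutative `k`-algebra `R`,
on a given `R`-module `H`, without any axioms. -/
@[ext]
structure HopfAlgebroidData (k R H : Type*) [CommRing k] [CommRing R] [Algebra k R]
    [AddCommGroup H] [Module k H] [Module R H] where
  mul : H →ₗ[k] H →ₗ[k] H
  one : H
  src : R →ₗ[k] H
  comul : H →ₗ[R] H ⊗[R] H
  counit : H →ₗ[R] R
  antipode : H →ₗ[k] H

namespace HopfAlgebroidData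

variable {k R H : Type*} [CommRing k] [CommRing R] [Algebra k R]
  [AddCommGroup H] [Module k H] [Module R H] [IsScalarTower k R H]

/-- `(H, ·, 1, Δ, ε, ι)` is a bialgebroid over `R`, the source map `ι` being also the target. -/
structure IsBialgebroid (D : HopfAlgebroidData k R H) : Prop where
  mul_assoc : ∀ x y z, D.mul (D.mul x y) z = D.mul x (D.mul y z)
  one_mul : ∀ x, D.mul D.one x = x
  mul_one : ∀ x, D.mul x D.one = x
  src_one : D.src 1 = D.one
  src_mul : ∀ f g, D.src (f * g) = D.mul (D.src f) (D.src g)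
  /-- The `R`-module structure on `H` is `f x = ι(f) x`. -/
  smul_eq : ∀ (f : R) (x : H), f • x = D.mul (D.src f) x
  coassoc : ∀ x, TensorProduct.assoc R H H H (D.comul.rTensor H (D.comul x)) =
    D.comul.lTensor H (D.comul x)
  /-- `Δ(x)(ι(f) ⊗ 1 - 1 ⊗ ι(f)) = 0`. -/
  comul_mul_src : ∀ (x : H) (f : R) (n : ℕ) (u v : Fin n → H), Represents (D.comul x) u v →
    ∑ i, D.mul (u i) (D.src f) ⊗ₜ[R] v i = ∑ i, u i ⊗ₜ[R] D.mul (v i) (D.src f)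
  comul_one : D.comul D.one = D.one ⊗ₜ[R] D.one
  comul_mul : ∀ (x y : H) (n m : ℕ) (u v : Fin n → H) (u' v' : Fin m → H),
    Represents (D.comul x) u v → Represents (D.comul y) u' v' →
    D.comul (D.mul x y) = ∑ i, ∑ j, D.mul (u i) (u' j) ⊗ₜ[R] D.mul (v i) (v' j)
  counit_one : D.counit D.one = 1
  /-- `ker ε` is a left ideal. -/
  counit_mul : ∀ x y, D.counit (D.mul x (y - D.src (D.counit y))) = 0
  counit_left : ∀ (x : H) (n : ℕ) (u v : Fin n → H), Represents (D.comul x) u v →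
    ∑ i, D.counit (u i) • v i = x
  counit_right : ∀ (x : H) (n : ℕ) (u v : Fin n → H), Represents (D.comul x) u v →
    ∑ i, D.counit (v i) • u i = x

/-- A Hopf algebroid over `R`, in the sense of Lu, for a commutative base with equal source
and target. As `x ⊗ y ↦ x S(y)` does not factor through `H ⊗_R H`, the identity
`m (id ⊗ S) Δ = ι ε` is read, as in Lu's definition, through a section `γ` of
`H ⊗_k H → H ⊗_R H`. -/
structure IsHopfAlgebroid (D : HopfAlgebroidData k R H) : Prop extends D.IsBialgebroid where
  antipode_bijective : Function.Bijective D.antipode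
  antipode_one : D.antipode D.one = D.one
  antipode_mul : ∀ x y, D.antipode (D.mul x y) = D.mul (D.antipode y) (D.antipode x)
  antipode_src : ∀ f, D.antipode (D.src f) = D.src f
  antipode_left : ∀ (x : H) (n : ℕ) (u v : Fin n → H), Represents (D.comul x) u v →
    ∑ i, D.mul (D.antipode (u i)) (v i) = D.src (D.counit (D.antipode x))
  antipode_right : ∃ γ : H ⊗[R] H →ₗ[k] H ⊗[k] H, IsProjSection γ ∧
    ∀ x, TensorProduct.lift (D.mul.compl₂ D.antipode) (γ (D.comul x)) = D.src (D.counit x)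

/-- The `R`-algebra `B` is a module algebra over the bialgebroid `H` via `x ⇀ b = act x b`.
The identity `(f x) ⇀ b = f (x ⇀ b)` is the `R`-linearity of `act`. -/
structure IsModuleAlgebra (D : HopfAlgebroidData k R H) {B : Type*} [Ring B] [Algebra k B]
    [Algebra R B] [IsScalarTower k R B] (act : H →ₗ[R] B →ₗ[k] B) : Prop where
  mul_act : ∀ x y b, act (D.mul x y) b = act x (act y b)
  one_act : ∀ b, act D.one b = b
  act_mul : ∀ (x : H) (b c : B) (n : ℕ) (u v : Fin n → H), Represents (D.comul x) u v →
    act x (b * c) = ∑ i, act (u i) b * act (v i) c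
  act_one : ∀ x, act x 1 = D.counit x • (1 : B)

end HopfAlgebroidData

/-! ### The smash product -/

section Smash

variable {k R A : Type*} [CommRing k] [CommRing R] [Algebra k R] [AddCommGroup A] [Module k A]

/-- For `a : A`, the endomorphism `g ⊗ b ↦ (a₁ ⇀ g) ⊗ a₂ b` of `R ⊗ A`. -/
def smashLeft (D : HopfAlgebroidData k k A) (act : A →ₗ[k] R →ₗ[k] R) :
    A →ₗ[k] (R ⊗[k] A →ₗ[k] R ⊗[k] A) :=
  TensorProduct.homTensorHomMap (.id k) R A R A ∘ₗ TensorProduct.map act D.mul ∘ₗ D.comul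

/-- The tuple of the smash product `R # A` on the `R`-module `R ⊗ A`, for the tuple `D` of a
Hopf algebra `A` over `k` and an action of `A` on `R`; see the formulas following it. -/
def smashProduct (D : HopfAlgebroidData k k A) (act : A →ₗ[k] R →ₗ[k] R) :
    HopfAlgebroidData k R (R ⊗[k] A) where
  mul := TensorProduct.lift <| LinearMap.mk₂ k (fun f a => f • smashLeft D act a)
    (fun f g a => add_smul f g _) (fun c f a => smul_assoc c f _)
    (fun f a b => by rw [map_add, smul_add]) (fun c f a => by rw [map_smul, smul_comm])
  one := 1 ⊗ₜ D.one
  src := (TensorProduct.mk k R A).flip D.one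
  comul := (TensorProduct.AlgebraTensorModule.distribBaseChange k R A A).toLinearMap ∘ₗ
    D.comul.baseChange R
  counit := (TensorProduct.AlgebraTensorModule.rid k R R).toLinearMap ∘ₗ D.counit.baseChange R
  antipode := TensorProduct.lift <| LinearMap.mk₂ k
    (fun f a => TensorProduct.map (act.flip f ∘ₗ D.antipode) D.antipode (D.comul a))
    (fun f g a => by
      rw [map_add, LinearMap.add_comp, TensorProduct.map_add_left, LinearMap.add_apply])
    (fun c f a => by
      rw [map_smul, LinearMap.smul_comp, TensorProduct.map_smul_left, LinearMap.smul_apply])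
    (fun f a b => by simp) (fun c f a => by simp)

variable (D : HopfAlgebroidData k k A) (act : A →ₗ[k] R →ₗ[k] R)

theorem smashProduct_mul {a : A} {n : ℕ} {u v : Fin n → A} (h : Represents (D.comul a) u v)
    (f g : R) (b : A) : (smashProduct D act).mul (f ⊗ₜ a) (g ⊗ₜ b) =
      ∑ i, (f * act (u i) g) ⊗ₜ[k] D.mul (v i) b := by
  simp only [Represents] at h
  simp [smashProduct, smashLeft, h, Finset.smul_sum, TensorProduct.smul_tmul']

theorem smashProduct_one : (smashProduct D act).one = 1 ⊗ₜ D.one := rfl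

theorem smashProduct_src (f : R) : (smashProduct D act).src f = f ⊗ₜ D.one := rfl

theorem smashProduct_comul {a : A} {n : ℕ} {u v : Fin n → A} (h : Represents (D.comul a) u v)
    (f : R) : (smashProduct D act).comul (f ⊗ₜ a) =
      ∑ i, (f ⊗ₜ[k] u i) ⊗ₜ[R] ((1 : R) ⊗ₜ[k] v i) := by
  simp only [Represents] at h
  simp [smashProduct, h, TensorProduct.tmul_sum]

theorem smashProduct_counit (f : R) (a : A) :
    (smashProduct D act).counit (f ⊗ₜ a) = f * algebraMap k R (D.counit a) := by
  simp [smashProduct, Algebra.smul_def, mul_comm]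

theorem smashProduct_antipode {a : A} {n : ℕ} {u v : Fin n → A}
    (h : Represents (D.comul a) u v) (f : R) : (smashProduct D act).antipode (f ⊗ₜ a) =
      ∑ i, act (D.antipode (u i)) f ⊗ₜ[k] D.antipode (v i) := by
  simp only [Represents] at h
  simp [smashProduct, h]

end Smash

/-! ### The Grossman-Larson product -/

/-- The Grossman-Larson product `x * y = x₁ (x₂ ▷ y)` of a product `▷` that is `R`-linear in
its first and `k`-linear in its second argument. -/
def grossmanLarsonMul {k R H : Type*} [CommRing k] [CommRing R] [Algebra k R] [Ring H]
    [Algebra k H] [HopfAlgebra R H] [IsScalarTower k R H] (tri : H →ₗ[R] H →ₗ[k] H) :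
    H →ₗ[k] H →ₗ[k] H :=
  LinearMap.mk₂ k
    (fun x y => TensorProduct.lift ((LinearMap.mul R H).compl₂ (tri.flip y))
      (Coalgebra.comul (R := R) x))
    (fun x x' y => by simp)
    (fun c x y => by
      rw [LinearMap.map_smul_of_tower, LinearMap.map_smul_of_tower])
    (fun x y y' => by
      induction Coalgebra.comul (R := R) x with
      | zero => simp
      | tmul a b => simp [mul_add]
      | add s t hs ht => rw [map_add, hs, ht, map_add, map_add]; abel)
    (fun c x y => by
      induction Coalgebra.comul (R := R) x with
      | zero => simp
      | tmul a b => simp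
      | add s t hs ht => rw [map_add, hs, ht, map_add, smul_add])

theorem grossmanLarsonMul_apply {k R H : Type*} [CommRing k] [CommRing R] [Algebra k R] [Ring H]
    [Algebra k H] [HopfAlgebra R H] [IsScalarTower k R H] (tri : H →ₗ[R] H →ₗ[k] H)
    {x : H} {n : ℕ} {u v : Fin n → H} (h : Represents (Coalgebra.comul (R := R) x) u v) (y : H) :
    grossmanLarsonMul tri x y = ∑ i, u i * tri (v i) y := by
  simp only [Represents] at h
  simp [grossmanLarsonMul, h]

/-! ### Post-Hopf algebras -/

/-- A post-Hopf algebra structure `x ▷ y = tri (x ⊗ y)` on a Hopf algebra `A`, where `▷` is a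
coalgebra homomorphism. The map `beta` is the (unique) convolution inverse of
`alpha : x ↦ (y ↦ x ▷ y)` in `Hom(A, End A)`. -/
structure PostHopfAlgebra (k A : Type*) [CommRing k] [Ring A] [HopfAlgebra k A] where
  tri : A ⊗[k] A →ₗc[k] A
  beta : A →ₗ[k] A →ₗ[k] A
  tri_mul : ∀ (x y z : A) (n : ℕ) (u v : Fin n → A), Represents (Coalgebra.comul (R := k) x) u v →
    tri (x ⊗ₜ (y * z)) = ∑ i, tri (u i ⊗ₜ y) * tri (v i ⊗ₜ z)
  tri_tri : ∀ (x y z : A) (n : ℕ) (u v : Fin n → A), Represents (Coalgebra.comul (R := k) x) u v →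
    tri (x ⊗ₜ tri (y ⊗ₜ z)) = ∑ i, tri ((u i * tri (v i ⊗ₜ y)) ⊗ₜ z)
  alpha_beta : ∀ (x y : A) (n : ℕ) (u v : Fin n → A), Represents (Coalgebra.comul (R := k) x) u v →
    ∑ i, tri (u i ⊗ₜ beta (v i) y) = Coalgebra.counit (R := k) x • y
  beta_alpha : ∀ (x y : A) (n : ℕ) (u v : Fin n → A), Represents (Coalgebra.comul (R := k) x) u v →
    ∑ i, beta (u i) (tri (v i ⊗ₜ y)) = Coalgebra.counit (R := k) x • y

/-- The tuple `A_▷ = (A, *_▷, 1, Δ, ε, S_▷)` of the sub-adjacent Hopf algebra, where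
`x *_▷ y = x₁ (x₂ ▷ y)` and `S_▷(x) = β_{x₁}(S(x₂))`. A Hopf algebra over `k` with bijective
antipode is the same as a Hopf algebroid with base `k`. -/
def PostHopfAlgebra.subAdjacent {k A : Type*} [CommRing k] [Ring A] [HopfAlgebra k A]
    (P : PostHopfAlgebra k A) : HopfAlgebroidData k k A where
  mul := grossmanLarsonMul (TensorProduct.curry P.tri.toLinearMap)
  one := 1
  src := Algebra.linearMap k A
  comul := Coalgebra.comul
  counit := Coalgebra.counit
  antipode := TensorProduct.lift (P.beta.compl₂ (HopfAlgebra.antipode k)) ∘ₗ Coalgebra.comul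

/-! ### Post-Hopf algebroids -/

/-- A weak post-Hopf algebroid structure over `R` on a cocommutative Hopf `R`-algebra `H`, with
`ι = algebraMap R H`. The identity `(f x) ▷ y = f (x ▷ y)` is the `R`-linearity of `tri` in its
first argument. -/
structure WeakPostHopfAlgebroid (k R H : Type*) [CommRing k] [CommRing R] [Algebra k R] [Ring H]
    [Algebra k H] [HopfAlgebra R H] [IsScalarTower k R H] where
  isCocomm : Coalgebra.IsCocomm R H
  tri : H →ₗ[R] H →ₗ[k] H
  comul_tri : ∀ (x y : H) (n m : ℕ) (u v : Fin n → H) (u' v' : Fin m → H),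
    Represents (Coalgebra.comul (R := R) x) u v → Represents (Coalgebra.comul (R := R) y) u' v' →
    Coalgebra.comul (R := R) (tri x y) = ∑ i, ∑ j, tri (u i) (u' j) ⊗ₜ[R] tri (v i) (v' j)
  tri_one : ∀ x, tri x 1 = algebraMap R H (Coalgebra.counit x)
  one_tri : ∀ x, tri 1 x = x
  counit_tri : ∀ x y, algebraMap R H (Coalgebra.counit (tri x y)) =
    tri x (algebraMap R H (Coalgebra.counit y))
  tri_mul : ∀ (x y z : H) (n : ℕ) (u v : Fin n → H),
    Represents (Coalgebra.comul (R := R) x) u v →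
    tri x (y * z) = ∑ i, tri (u i) y * tri (v i) z
  tri_tri : ∀ (x y z : H) (n : ℕ) (u v : Fin n → H),
    Represents (Coalgebra.comul (R := R) x) u v →
    tri x (tri y z) = tri (∑ i, u i * tri (v i) y) z

/-- A post-Hopf algebroid over `R`: a weak one with an algebra anti-automorphism `θ` of its
Grossman-Larson bialgebroid such that `Δ(θ(x)) = θ(x₁) ⊗_R θ(x₂)`, `x₁ * θ(x₂) = ι(ε(x))` and
`θ(x₁) * x₂ = ι(ε(θ(x)))`. The left-hand side of the third identity is well defined on
`H ⊗_R H`. The expressions in the first two are not, so these are read through a section `γ`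
of `H ⊗_k H → H ⊗_R H`, as in Lu's definition of a Hopf algebroid. -/
structure PostHopfAlgebroid (k R H : Type*) [CommRing k] [CommRing R] [Algebra k R] [Ring H]
    [Algebra k H] [HopfAlgebra R H] [IsScalarTower k R H] extends
    WeakPostHopfAlgebroid k R H where
  theta : H →ₗ[k] H
  theta_bijective : Function.Bijective theta
  theta_one : theta 1 = 1
  theta_mul : ∀ x y, theta (grossmanLarsonMul tri x y) =
    grossmanLarsonMul tri (theta y) (theta x)
  comul_theta_and_mul_theta : ∃ γ : H ⊗[R] H →ₗ[k] H ⊗[k] H, IsProjSection γ ∧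
    (∀ x, Coalgebra.comul (R := R) (theta x) =
      proj k R H (TensorProduct.map theta theta (γ (Coalgebra.comul x)))) ∧
    (∀ x, TensorProduct.lift ((grossmanLarsonMul tri).compl₂ theta) (γ (Coalgebra.comul x)) =
      algebraMap R H (Coalgebra.counit x))
  theta_mul_self : ∀ (x : H) (n : ℕ) (u v : Fin n → H),
    Represents (Coalgebra.comul (R := R) x) u v →
    ∑ i, grossmanLarsonMul tri (theta (u i)) (v i) =
      algebraMap R H (Coalgebra.counit (theta x))

/-- The tuple `H_▷ = (H, *_▷, 1, Δ, ε, θ, ι)` of the Grossman-Larson Hopf algebroid. -/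
def PostHopfAlgebroid.grossmanLarson {k R H : Type*} [CommRing k] [CommRing R] [Algebra k R]
    [Ring H] [Algebra k H] [HopfAlgebra R H] [IsScalarTower k R H]
    (Q : PostHopfAlgebroid k R H) : HopfAlgebroidData k R H where
  mul := grossmanLarsonMul Q.tri
  one := 1
  src := (IsScalarTower.toAlgHom k R H).toLinearMap
  comul := Coalgebra.comul
  counit := Coalgebra.counit
  antipode := Q.theta

end

end PostHopf

/-! The theorem rests on one identity: on `R ⊗ A`, the Grossman-Larson product of the extended `▷`
is the product of the smash product `R # A_▷`. Once this is known (`grossmanLarsonMul_actTri`),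
every statement about `θ` concerns a smash product of a cocommutative Hopf algebra with a
commutative module algebra, and the post-Hopf structure no longer enters.

The extended `▷` and the smash product are instances of a single construction, `twistMul`: `(fa, gb)
↦ f (a₁ ⇀ g) φ(a₂, b)` for a bilinear coalgebra map `φ`, with `φ = ▷` or `φ = *_▷`. The central
lemma is `sum_twist_smul_tmul`. By cocommutativity, a scalar on which `a₁` acts in the first leg may
be moved to the second leg, where `a₂` acts on it. This makes the expressions balanced over `R` and
yields both the compatibility with `Δ` and the condition `Δ(x)(ι(f) ⊗ 1 - 1 ⊗ ι(f)) = 0`.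

For a cocommutative Hopf algebra `B`, the antipode of `R # B` is `θ(fa) = S(a) · f`, the product
taken in `R # B`. Anti-multiplicativity, involutivity and the antipode identities follow by
computing with this form (`smashAntipode_tmul`).

It remains to know that `A_▷` is a Hopf algebra. Cocommutativity makes `*_▷` a coalgebra map, and
`S_▷` is a right inverse by a direct computation. It is also a left inverse because, in the
convolution algebra `Hom(A, End A)`, left multiplication for `*_▷` is the product of ordinary left
multiplication and `α`, both invertible (`sum_antipode_gl`). The synonym `SubAdj P` carries this
Hopf algebra, to which the general results are applied. -/

namespace PostHopf

/-! ### Sweedler calculus with explicit presentations of coproducts -/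

section Sweedler

open Coalgebra

theorem Represents.map_lift {k M N X : Type*} [CommRing k] [AddCommGroup M] [AddCommGroup N]
    [AddCommGroup X] [Module k M] [Module k N] [Module k X] {t : M ⊗[k] N} {n : ℕ}
    {u : Fin n → M} {v : Fin n → N} (h : Represents t u v) (f : M →ₗ[k] N →ₗ[k] X) :
    TensorProduct.lift f t = ∑ i, f (u i) (v i) := by
  rw [h, map_sum]; rfl

theorem Represents.of_eq {k M N : Type*} [CommRing k] [AddCommGroup M] [AddCommGroup N]
    [Module k M] [Module k N] {ι : Type*} [Fintype ι] (t : M ⊗[k] N) (u : ι → M) (v : ι → N)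
    (h : t = ∑ i, u i ⊗ₜ[k] v i) :
    Represents t (u ∘ (Fintype.equivFin ι).symm) (v ∘ (Fintype.equivFin ι).symm) := by
  rw [Represents, h]
  exact (Equiv.sum_comp (Fintype.equivFin ι).symm fun i => u i ⊗ₜ[k] v i).symm

variable {k C M : Type*} [CommRing k] [AddCommGroup C] [Module k C] [Coalgebra k C]
  [AddCommGroup M] [Module k M]

/-- The trilinear map with underlying function `F`. -/
def trilinear (F : C → C → C → M) (h₁ : ∀ y z, IsLinearMap k fun x => F x y z)
    (h₂ : ∀ x z, IsLinearMap k fun y => F x y z) (h₃ : ∀ x y, IsLinearMap k fun z => F x y z) :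
    C →ₗ[k] C →ₗ[k] C →ₗ[k] M :=
  LinearMap.mk₂ k (fun x y => (h₃ x y).mk' _)
    (fun _ _ _ => LinearMap.ext fun _ => (h₁ _ _).map_add _ _)
    (fun _ _ _ => LinearMap.ext fun _ => (h₁ _ _).map_smul _ _)
    (fun _ _ _ => LinearMap.ext fun _ => (h₂ _ _).map_add _ _)
    (fun _ _ _ => LinearMap.ext fun _ => (h₂ _ _).map_smul _ _)

variable {a : C} {n : ℕ} {u v : Fin n → C}

theorem Represents.swap [IsCocomm k C] (h : Represents (comul (R := k) a) u v) :
    Represents (comul (R := k) a) v u := by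
  rw [Represents, ← comm_comul k a, h, map_sum]; rfl

theorem Represents.sum_counit_smul (h : Represents (comul (R := k) a) u v) :
    ∑ i, counit (R := k) (u i) • v i = a := by
  have := congrArg (TensorProduct.lid k C) (rTensor_counit_comul (R := k) a)
  rw [h] at this
  simpa using this

theorem Represents.sum_counit_smul' (h : Represents (comul (R := k) a) u v) :
    ∑ i, counit (R := k) (v i) • u i = a := by
  have := congrArg (TensorProduct.rid k C) (lTensor_counit_comul (R := k) a)
  rw [h] at this
  simpa using this

/-- This is `x₁₁ ⊗ x₁₂ ⊗ x₂ = x₁ ⊗ x₂₁ ⊗ x₂₂` with a trilinear `F` applied to both sides. Together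
with `sum_coassoc_swap` it carries out nearly all the Sweedler manipulations below; each use amounts
to choosing `F`. -/
theorem Represents.sum_coassoc {m l : Fin n → ℕ} {p q : ∀ i, Fin (m i) → C}
    {r s : ∀ i, Fin (l i) → C} (h : Represents (comul (R := k) a) u v)
    (hu : ∀ i, Represents (comul (R := k) (u i)) (p i) (q i))
    (hv : ∀ i, Represents (comul (R := k) (v i)) (r i) (s i))
    (F : C → C → C → M) (h₁ : ∀ y z, IsLinearMap k fun x => F x y z)
    (h₂ : ∀ x z, IsLinearMap k fun y => F x y z) (h₃ : ∀ x y, IsLinearMap k fun z => F x y z) :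
    ∑ i, ∑ j, F (p i j) (q i j) (v i) = ∑ i, ∑ j, F (u i) (r i j) (s i j) := by
  have key := congrArg (TensorProduct.lift (TensorProduct.lift (trilinear F h₁ h₂ h₃)) ∘ₗ
    (TensorProduct.assoc k C C C).symm.toLinearMap) (coassoc_apply (R := k) a)
  rw [h] at key
  simp only [map_sum, LinearMap.rTensor_tmul, LinearMap.lTensor_tmul] at key
  simp_rw [fun i => show comul (R := k) (u i) = _ from hu i,
    fun i => show comul (R := k) (v i) = _ from hv i] at key
  simpa [TensorProduct.sum_tmul, TensorProduct.tmul_sum, trilinear] using key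

theorem Represents.sum_coassoc_swap [IsCocomm k C] {m l : Fin n → ℕ} {p q : ∀ i, Fin (m i) → C}
    {r s : ∀ i, Fin (l i) → C} (h : Represents (comul (R := k) a) u v)
    (hu : ∀ i, Represents (comul (R := k) (u i)) (p i) (q i))
    (hv : ∀ i, Represents (comul (R := k) (v i)) (r i) (s i))
    (F : C → C → C → M) (h₁ : ∀ y z, IsLinearMap k fun x => F x y z)
    (h₂ : ∀ x z, IsLinearMap k fun y => F x y z) (h₃ : ∀ x y, IsLinearMap k fun z => F x y z) :
    ∑ i, ∑ j, F (p i j) (q i j) (v i) = ∑ i, ∑ j, F (r i j) (u i) (s i j) :=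
  h.sum_coassoc (fun i => (hu i).swap) hv (fun x y z => F y x z) (fun _ _ => h₂ _ _)
    (fun _ _ => h₁ _ _) (fun _ _ => h₃ _ _)

end Sweedler

/-! ### The antipode of a cocommutative Hopf algebra -/

section Antipode

open Coalgebra HopfAlgebra LinearMap WithConv

variable {k B : Type*} [CommRing k] [Ring B] [HopfAlgebra k B]

theorem Represents.sum_antipode_mul {x : B} {n : ℕ} {u v : Fin n → B}
    (h : Represents (comul (R := k) x) u v) :
    ∑ i, HopfAlgebra.antipode k (u i) * v i = algebraMap k B (counit x) := by
  have := mul_antipode_rTensor_comul_apply (R := k) x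
  rw [h] at this
  simpa using this

theorem Represents.sum_mul_antipode {x : B} {n : ℕ} {u v : Fin n → B}
    (h : Represents (comul (R := k) x) u v) :
    ∑ i, u i * HopfAlgebra.antipode k (v i) = algebraMap k B (counit x) := by
  have := mul_antipode_lTensor_comul_apply (R := k) x
  rw [h] at this
  simpa using this

variable [IsCocomm k B]

/-- Both sides are convolution inverses of `Δ` in `Hom(B, B ⊗ B)`. For `(S ⊗ S)Δ`, the identity `(S
⊗ S) * (id ⊗ id) = (S * id) ⊗ (S * id)` is precomposed with `Δ`, which is a coalgebra map by
cocommutativity. -/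
theorem comul_comp_antipode_of_isCocomm :
    comul ∘ₗ antipode k (A := B) = TensorProduct.map (antipode k) (antipode k) ∘ₗ comul := by
  apply WithConv.toConv_injective
  symm
  refine left_inv_eq_right_inv (a := toConv (comul (R := k) (A := B))) ?_ comul_right_inv
  have h := convMul_comp_coalgHom_distrib
    (toConv (TensorProduct.map (antipode k (A := B)) (antipode k (A := B))))
    (toConv (TensorProduct.map (LinearMap.id (R := k) (M := B)) LinearMap.id))
    (comulCoalgHom k B)
  have h2 := TensorProduct.map_convMul_map (f := toConv (antipode k (A := B)))
    (g := toConv (antipode k (A := B))) (h := toConv (LinearMap.id (R := k) (M := B)))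
    (k := toConv (LinearMap.id (R := k) (M := B)))
  simp only at h2
  rw [h2] at h
  apply WithConv.ext
  have e : (comulCoalgHom k B).toLinearMap = comul := rfl
  simp only [e, TensorProduct.map_id, LinearMap.id_comp, antipode_mul_id] at h
  rw [← h]
  ext x
  obtain ⟨n, u, v, hx⟩ := exists_represents (comul (R := k) x)
  have h3 := hx.sum_counit_smul
  conv_rhs => rw [← h3]
  simp [LinearMap.convOne_def, show comul (R := k) x = _ from hx, Algebra.algebraMap_eq_smul_one,
    TensorProduct.smul_tmul', TensorProduct.tmul_smul, smul_smul, Algebra.TensorProduct.one_def,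
    mul_comm]

/-- Precomposing `S * id = 1` with the coalgebra map `S` gives `S² * S = 1`, so `S²` and `id` are a
left and a right convolution inverse of `S`. -/
theorem antipode_antipode_of_isCocomm (x : B) : antipode k (antipode k x) = x := by
  have h : toConv (antipode k ∘ₗ antipode k (A := B)) = toConv LinearMap.id := by
    refine left_inv_eq_right_inv (a := toConv (antipode k (A := B))) ?_ antipode_mul_id
    apply WithConv.ext
    have h1 := congrArg (fun f : WithConv (B →ₗ[k] B) => f.ofConv ∘ₗ antipode k)
      (antipode_mul_id (R := k) (C := B))
    simp only [LinearMap.convMul_def, ofConv_toConv, LinearMap.comp_assoc, comul_comp_antipode_of_isCocomm]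
      at h1 ⊢
    rw [← LinearMap.comp_assoc _ _ (TensorProduct.map _ _), ← TensorProduct.map_comp] at h1
    simp only [LinearMap.id_comp] at h1
    rw [h1]
    ext x
    simp [LinearMap.convOne_def]
  exact LinearMap.congr_fun (congrArg WithConv.ofConv h) x

theorem Represents.antipode {x : B} {n : ℕ} {u v : Fin n → B}
    (h : Represents (comul (R := k) x) u v) :
    Represents (comul (R := k) (antipode k x)) (fun i => antipode k (u i))
      (fun i => antipode k (v i)) := by
  have := LinearMap.congr_fun (comul_comp_antipode_of_isCocomm (k := k) (B := B)) x
  rw [LinearMap.comp_apply, LinearMap.comp_apply, h, map_sum] at this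
  exact this

end Antipode


/-! ### Twisted products on `R ⊗ C` for a coalgebra `C` acting on `R` -/

section Twist

open Coalgebra

variable {k R C : Type*} [CommRing k] [CommRing R] [Algebra k R] [AddCommGroup C] [Module k C]
  [Coalgebra k C]

/-- The coalgebra `C` measures the algebra `R` to itself. -/
structure IsMeasuring (act : C →ₗ[k] R →ₗ[k] R) : Prop where
  act_mul : ∀ (a : C) (f g : R) (n : ℕ) (u v : Fin n → C), Represents (comul (R := k) a) u v →
    act a (f * g) = ∑ i, act (u i) f * act (v i) g
  act_one : ∀ a, act a 1 = algebraMap k R (counit a)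

/-- The bilinear map `φ`, seen as a map `C ⊗ C → C`, is a coalgebra homomorphism. -/
structure IsCoalgBilin (φ : C →ₗ[k] C →ₗ[k] C) : Prop where
  comul_apply : ∀ (a b : C) (n m : ℕ) (u v : Fin n → C) (u' v' : Fin m → C),
    Represents (comul (R := k) a) u v → Represents (comul (R := k) b) u' v' →
    comul (R := k) (φ a b) = ∑ i, ∑ j, φ (u i) (u' j) ⊗ₜ[k] φ (v i) (v' j)
  counit_apply : ∀ a b, counit (R := k) (φ a b) = counit (R := k) a * counit (R := k) b

theorem comul_tmul_of_represents {a : C} {n : ℕ} {u v : Fin n → C}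
    (h : Represents (comul (R := k) a) u v) (f : R) :
    comul (R := R) (f ⊗ₜ[k] a) = ∑ i, (f ⊗ₜ[k] u i) ⊗ₜ[R] ((1 : R) ⊗ₜ[k] v i) := by
  simp only [Represents] at h
  rw [TensorProduct.comul_tmul, h, TensorProduct.tmul_sum, map_sum, CommSemiring.comul_apply]
  simp only [TensorProduct.AlgebraTensorModule.tensorTensorTensorComm_tmul]
  refine Finset.sum_congr rfl fun i _ => ?_
  rw [← mul_one f, ← smul_eq_mul, ← TensorProduct.smul_tmul', TensorProduct.tmul_smul,
    ← TensorProduct.smul_tmul', TensorProduct.smul_tmul']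

theorem represents_comul_tmul {a : C} {n : ℕ} {u v : Fin n → C}
    (h : Represents (comul (R := k) a) u v) (f : R) :
    Represents (comul (R := R) (f ⊗ₜ[k] a)) (fun i => f ⊗ₜ[k] u i) (fun i => (1 : R) ⊗ₜ[k] v i) :=
  comul_tmul_of_represents h f

/-- To evaluate a balanced expression `F(x₁, x₂)` at `x : R ⊗ C`, it suffices to treat the
standard presentations of the coproducts of pure tensors. -/
theorem Represents.sum_balanced {P : Type*} [AddCommGroup P] {x : R ⊗[k] C} {n : ℕ}
    {u v : Fin n → R ⊗[k] C} (h : Represents (comul (R := R) x) u v)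
    (F : R ⊗[k] C → R ⊗[k] C → P)
    (add_left : ∀ s s' t, F (s + s') t = F s t + F s' t)
    (add_right : ∀ s t t', F s (t + t') = F s t + F s t')
    (balanced : ∀ (g : R) s t, F (g • s) t = F s (g • t))
    (G : R ⊗[k] C →+ P)
    (hG : ∀ (f : R) (a : C) (n : ℕ) (u v : Fin n → C), Represents (comul (R := k) a) u v →
      ∑ i, F (f ⊗ₜ u i) (1 ⊗ₜ v i) = G (f ⊗ₜ a)) :
    ∑ i, F (u i) (v i) = G x := by
  -- Additivity and balancedness suffice for the descent to `H ⊗_R H`. No `R`-linearity is asked of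
  -- `F`, so `θ(x₁) x₂` is covered although `θ` is only `k`-linear.
  let Λ : (R ⊗[k] C) ⊗[R] (R ⊗[k] C) →+ P := TensorProduct.liftAddHom
    (AddMonoidHom.mk' (fun s => AddMonoidHom.mk' (F s) (add_right s))
      fun s s' => AddMonoidHom.ext (add_left s s')) balanced
  have key : Λ (comul x) = G x := by
    clear h
    induction x with
    | zero => simp
    | add x y hx hy => simp only [map_add, hx, hy]
    | tmul f a =>
      obtain ⟨m, p, q, hpq⟩ := exists_represents (comul (R := k) a)
      rw [comul_tmul_of_represents hpq, map_sum, ← hG f a m p q hpq]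
      rfl
  rw [← key, h, map_sum]
  rfl

theorem Represents.sum_balanced_congr {P : Type*} [AddCommGroup P] {x : R ⊗[k] C} {n : ℕ}
    {u v : Fin n → R ⊗[k] C} (h : Represents (comul (R := R) x) u v)
    (F G : R ⊗[k] C → R ⊗[k] C → P)
    (add_left : ∀ s s' t, F (s + s') t = F s t + F s' t)
    (add_right : ∀ s t t', F s (t + t') = F s t + F s t')
    (balanced : ∀ (g : R) s t, F (g • s) t = F s (g • t))
    (add_left' : ∀ s s' t, G (s + s') t = G s t + G s' t)
    (add_right' : ∀ s t t', G s (t + t') = G s t + G s t')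
    (balanced' : ∀ (g : R) s t, G (g • s) t = G s (g • t))
    (hFG : ∀ (f : R) (a : C) (n : ℕ) (u v : Fin n → C), Represents (comul (R := k) a) u v →
      ∑ i, F (f ⊗ₜ u i) (1 ⊗ₜ v i) = ∑ i, G (f ⊗ₜ u i) (1 ⊗ₜ v i)) :
    ∑ i, F (u i) (v i) = ∑ i, G (u i) (v i) := by
  rw [← sub_eq_zero, ← Finset.sum_sub_distrib]
  refine h.sum_balanced (fun s t => F s t - G s t)
    (fun _ _ _ => by rw [add_left, add_left']; abel)
    (fun _ _ _ => by rw [add_right, add_right']; abel)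
    (fun _ _ _ => by rw [balanced, balanced']) 0 fun f a n u v h => ?_
  rw [Finset.sum_sub_distrib, hFG f a n u v h, sub_self, AddMonoidHom.zero_apply]

variable (act : C →ₗ[k] R →ₗ[k] R) (φ : C →ₗ[k] C →ₗ[k] C)

/-- For `a : C`, the endomorphism `g ⊗ b ↦ (a₁ ⇀ g) ⊗ φ(a₂, b)` of `R ⊗ C`. -/
noncomputable def twist : C →ₗ[k] (R ⊗[k] C →ₗ[k] R ⊗[k] C) :=
  TensorProduct.homTensorHomMap (.id k) R C R C ∘ₗ TensorProduct.map act φ ∘ₗ comul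

/-- The product `(f ⊗ a, g ⊗ b) ↦ f (a₁ ⇀ g) ⊗ φ(a₂, b)` on `R ⊗ C`. -/
noncomputable def twistMul : R ⊗[k] C →ₗ[R] (R ⊗[k] C →ₗ[k] R ⊗[k] C) :=
  TensorProduct.AlgebraTensorModule.lift
    (LinearMap.toSpanSingleton R (C →ₗ[k] (R ⊗[k] C →ₗ[k] R ⊗[k] C)) (twist act φ))

theorem twistMul_tmul (f : R) (a : C) (y : R ⊗[k] C) :
    twistMul act φ (f ⊗ₜ a) y = f • twist act φ a y := rfl

variable {a : C} {n : ℕ} {u v : Fin n → C}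

theorem twist_tmul (h : Represents (comul (R := k) a) u v) (f : R) (b : C) :
    twist act φ a (f ⊗ₜ b) = ∑ i, act (u i) f ⊗ₜ[k] φ (v i) b := by
  simp only [Represents] at h
  simp [twist, h]

variable {act φ}

theorem twist_one_tmul (hact : IsMeasuring act) (a b : C) :
    twist act φ a (1 ⊗ₜ b) = 1 ⊗ₜ φ a b := by
  obtain ⟨n, u, v, h⟩ := exists_represents (comul (R := k) a)
  conv_rhs => rw [← h.sum_counit_smul]
  simp [twist_tmul act φ h, hact.act_one, Algebra.algebraMap_eq_smul_one,
    TensorProduct.smul_tmul', TensorProduct.tmul_sum]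

theorem twist_smul (hact : IsMeasuring act) (h : Represents (comul (R := k) a) u v) (g : R)
    (y : R ⊗[k] C) : twist act φ a (g • y) = ∑ i, act (u i) g • twist act φ (v i) y := by
  induction y with
  | zero => simp
  | add x y hx hy => simp only [smul_add, map_add, hx, hy, Finset.sum_add_distrib]
  | tmul f b =>
    choose m p q hpq using fun i => exists_represents (comul (R := k) (u i))
    choose l r s hrs using fun i => exists_represents (comul (R := k) (v i))
    have := h.sum_coassoc hpq hrs (fun x y z => (act x g * act y f) ⊗ₜ[k] φ z b)
      (fun _ _ => by constructor <;> simp [add_mul, TensorProduct.add_tmul, TensorProduct.smul_tmul'])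
      (fun _ _ => by constructor <;> simp [mul_add, TensorProduct.add_tmul, TensorProduct.smul_tmul'])
      (fun _ _ => by constructor <;> simp [TensorProduct.tmul_add])
    simp only [TensorProduct.smul_tmul', smul_eq_mul, twist_tmul act φ h,
      fun i => twist_tmul act φ (hrs i), fun i => hact.act_mul _ g f _ _ _ (hpq i),
      TensorProduct.sum_tmul, this, Finset.smul_sum]

/-- Write `a · y` for `twist act φ a y`. The two sides expand to `(a₁ ⇀ g)(a₂ · y ⊗ a₃ · z)` and
`(a₂ ⇀ g)(a₁ · y ⊗ a₃ · z)`, which agree by cocommutativity. Thus the diagonal action of `a`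
descends to the tensor product over `R`. -/
theorem sum_twist_smul_tmul [IsCocomm k C] (hact : IsMeasuring act)
    (h : Represents (comul (R := k) a) u v) (g : R) (y z : R ⊗[k] C) :
    ∑ i, twist act φ (u i) (g • y) ⊗ₜ[R] twist act φ (v i) z =
      ∑ i, twist act φ (u i) y ⊗ₜ[R] twist act φ (v i) (g • z) := by
  choose m p q hpq using fun i => exists_represents (comul (R := k) (u i))
  choose l r s hrs using fun i => exists_represents (comul (R := k) (v i))
  have := h.sum_coassoc_swap hpq hrs
    (fun x y' z' => act x g • (twist act φ y' y ⊗ₜ[R] twist act φ z' z))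
    (fun _ _ => by constructor <;> simp [add_smul])
    (fun _ _ => by
      constructor <;> simp [TensorProduct.add_tmul, TensorProduct.smul_tmul', smul_comm (_ : R) (_ : k)])
    (fun _ _ => by constructor <;> simp [TensorProduct.tmul_add, smul_comm (_ : R) (_ : k)])
  simp only [fun i => twist_smul (φ := φ) hact (hpq i), fun i => twist_smul (φ := φ) hact (hrs i),
    TensorProduct.sum_tmul, TensorProduct.tmul_sum, TensorProduct.tmul_smul]
  simpa [TensorProduct.smul_tmul'] using this

/-- By `sum_twist_smul_tmul` the right-hand side is balanced in the legs of `Δ(y)`, so only `y = gb`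
with its standard presentation matters. There `a₂ · (1 ⊗ b') = 1 ⊗ φ(a₂, b')`, and coassociativity
finishes. -/
theorem comul_twist [IsCocomm k C] (hact : IsMeasuring act) (hφ : IsCoalgBilin φ)
    (h : Represents (comul (R := k) a) u v) {y : R ⊗[k] C} {m : ℕ} {u' v' : Fin m → R ⊗[k] C}
    (hy : Represents (comul (R := R) y) u' v') :
    comul (R := R) (twist act φ a y) =
      ∑ i, ∑ j, twist act φ (u i) (u' j) ⊗ₜ[R] twist act φ (v i) (v' j) := by
  rw [Finset.sum_comm]
  symm
  refine hy.sum_balanced (fun s t => ∑ i, twist act φ (u i) s ⊗ₜ[R] twist act φ (v i) t)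
    (fun _ _ _ => by simp [TensorProduct.add_tmul, Finset.sum_add_distrib])
    (fun _ _ _ => by simp [TensorProduct.tmul_add, Finset.sum_add_distrib])
    (fun g s t => sum_twist_smul_tmul hact h g s t)
    ((comul (R := R) (A := R ⊗[k] C)).toAddMonoidHom.comp (twist act φ a).toAddMonoidHom) ?_
  intro g b m u' v' hb
  choose m p q hpq using fun i => exists_represents (comul (R := k) (u i))
  choose l r s hrs using fun i => exists_represents (comul (R := k) (v i))
  simp only [AddMonoidHom.comp_apply, LinearMap.toAddMonoidHom_coe, twist_tmul act φ h, map_sum]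
  rw [Finset.sum_comm]
  simp only [fun i => twist_tmul act φ (hpq i), twist_one_tmul hact, TensorProduct.sum_tmul]
  have key (i) : comul (R := R) (act (u i) g ⊗ₜ[k] φ (v i) b) =
      ∑ j, ∑ j', (act (u i) g ⊗ₜ[k] φ (r i j) (u' j')) ⊗ₜ[R] ((1 : R) ⊗ₜ[k] φ (s i j) (v' j')) := by
    have h1 := hφ.comul_apply _ _ _ _ _ _ _ _ (hrs i) hb
    -- Presentations are indexed by one `Fin`, so the double sum is first turned into a sum over
    -- pairs and then reindexed.
    rw [← Finset.univ.sum_product' Finset.univ (fun j j' => φ (r i j) (u' j') ⊗ₜ[k] φ (s i j) (v' j')),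
      Finset.univ_product_univ] at h1
    have h2 := comul_tmul_of_represents (Represents.of_eq _ _ _ h1) (act (u i) g)
    rw [h2, ← Finset.univ.sum_product' Finset.univ, Finset.univ_product_univ]
    exact Equiv.sum_comp (Fintype.equivFin _).symm (fun j : Fin (l i) × Fin _ =>
      (act (u i) g ⊗ₜ[k] φ (r i j.1) (u' j.2)) ⊗ₜ[R] ((1 : R) ⊗ₜ[k] φ (s i j.1) (v' j.2)))
  simp only [key]
  have := h.sum_coassoc hpq hrs
    (fun x y z => ∑ j', (act x g ⊗ₜ[k] φ y (u' j')) ⊗ₜ[R] ((1 : R) ⊗ₜ[k] φ z (v' j')))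
    (fun _ _ => by
      constructor <;>
      simp [TensorProduct.add_tmul, Finset.sum_add_distrib, TensorProduct.smul_tmul', Finset.smul_sum])
    (fun _ _ => by
      constructor <;>
      simp [TensorProduct.add_tmul, TensorProduct.tmul_add, Finset.sum_add_distrib,
        TensorProduct.smul_tmul', Finset.smul_sum])
    (fun _ _ => by
      constructor <;>
      simp [TensorProduct.tmul_add, Finset.sum_add_distrib, Finset.smul_sum])
  rw [← this]
  exact Finset.sum_congr rfl fun i _ => Finset.sum_comm

theorem comul_twistMul [IsCocomm k C] (hact : IsMeasuring act) (hφ : IsCoalgBilin φ)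
    {x y : R ⊗[k] C} {n m : ℕ} {u v : Fin n → R ⊗[k] C} {u' v' : Fin m → R ⊗[k] C}
    (hx : Represents (comul (R := R) x) u v) (hy : Represents (comul (R := R) y) u' v') :
    comul (R := R) (twistMul act φ x y) =
      ∑ i, ∑ j, twistMul act φ (u i) (u' j) ⊗ₜ[R] twistMul act φ (v i) (v' j) := by
  symm
  refine hx.sum_balanced
    (fun s t => ∑ j, twistMul act φ s (u' j) ⊗ₜ[R] twistMul act φ t (v' j))
    (fun _ _ _ => by simp [TensorProduct.add_tmul, Finset.sum_add_distrib])
    (fun _ _ _ => by simp [TensorProduct.tmul_add, Finset.sum_add_distrib])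
    (fun g s t => by simp [TensorProduct.smul_tmul])
    (comul (R := R) (A := R ⊗[k] C) ∘ₗ (twistMul act φ).flip y).toAddMonoidHom ?_
  intro f a n u v h
  simp only [LinearMap.toAddMonoidHom_coe, LinearMap.comp_apply, LinearMap.flip_apply,
    twistMul_tmul, map_smul, comul_twist hact hφ h hy, one_smul, Finset.smul_sum,
    TensorProduct.smul_tmul']

theorem sum_twistMul_smul_tmul [IsCocomm k C] (hact : IsMeasuring act) {x : R ⊗[k] C} {n : ℕ}
    {u v : Fin n → R ⊗[k] C} (h : Represents (comul (R := R) x) u v) (g : R) (y z : R ⊗[k] C) :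
    ∑ i, twistMul act φ (u i) (g • y) ⊗ₜ[R] twistMul act φ (v i) z =
      ∑ i, twistMul act φ (u i) y ⊗ₜ[R] twistMul act φ (v i) (g • z) := by
  refine h.sum_balanced_congr
    (fun s t => twistMul act φ s (g • y) ⊗ₜ[R] twistMul act φ t z)
    (fun s t => twistMul act φ s y ⊗ₜ[R] twistMul act φ t (g • z))
    (fun _ _ _ => by simp [TensorProduct.add_tmul]) (fun _ _ _ => by simp [TensorProduct.tmul_add])
    (fun g s t => by simp [TensorProduct.smul_tmul])
    (fun _ _ _ => by simp [TensorProduct.add_tmul]) (fun _ _ _ => by simp [TensorProduct.tmul_add])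
    (fun g s t => by simp [TensorProduct.smul_tmul]) fun f a n u v h => ?_
  have := congrArg (f • ·) (sum_twist_smul_tmul (φ := φ) hact h g y z)
  simpa only [twistMul_tmul, one_smul, Finset.smul_sum, TensorProduct.smul_tmul'] using this

theorem counit_twist (hφ : IsCoalgBilin φ) (a : C) (y : R ⊗[k] C) :
    counit (R := R) (twist act φ a y) = act a (counit y) := by
  induction y with
  | zero => simp
  | add x y hx hy => simp only [map_add, hx, hy]
  | tmul f b =>
    obtain ⟨n, u, v, h⟩ := exists_represents (comul (R := k) a)
    conv_rhs => rw [← h.sum_counit_smul']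
    simp [twist_tmul act φ h, hφ.counit_apply, smul_smul, Finset.smul_sum, mul_comm]

/-- If `m` is a coalgebra map acting through both `⇀` and `φ`, then it acts on `R ⊗ C` diagonally.
This is used for a Hopf algebra acting on itself by multiplication, and for `*_▷` acting through
`▷`. -/
theorem twist_apply_apply {m : C →ₗ[k] C →ₗ[k] C} (hm : IsCoalgBilin m)
    (hact : ∀ a b f, act (m a b) f = act a (act b f))
    (hφ : ∀ a b c, φ (m a b) c = φ a (φ b c)) (a b : C) (y : R ⊗[k] C) :
    twist act φ (m a b) y = twist act φ a (twist act φ b y) := by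
  induction y with
  | zero => simp
  | add x y hx hy => simp only [map_add, hx, hy]
  | tmul f c =>
    obtain ⟨n, u, v, h⟩ := exists_represents (comul (R := k) a)
    obtain ⟨n', u', v', h'⟩ := exists_represents (comul (R := k) b)
    have h1 := hm.comul_apply _ _ _ _ _ _ _ _ h h'
    have h2 : twist act φ (m a b) (f ⊗ₜ c) =
        ∑ i, ∑ j, act (m (u i) (u' j)) f ⊗ₜ[k] φ (m (v i) (v' j)) c := by
      simp [twist, h1]
    simp only [h2, twist_tmul act φ h', map_sum, twist_tmul act φ h, hact, hφ]
    exact Finset.sum_comm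

end Twist


/-! ### Hopf algebras over `k` and the smash product `R # B` -/

section Hopf

open Coalgebra

variable {k R B : Type*} [CommRing k] [CommRing R] [Algebra k R] [Ring B] [HopfAlgebra k B]

variable (k B) in
/-- The tuple of a Hopf algebra over `k`. -/
noncomputable def HopfAlgebroidData.ofHopfAlgebra : HopfAlgebroidData k k B where
  mul := LinearMap.mul k B
  one := 1
  src := Algebra.linearMap k B
  comul := Coalgebra.comul
  counit := Coalgebra.counit
  antipode := HopfAlgebra.antipode k

theorem isProjSection_id : IsProjSection (k := k) (R := k) (H := B) LinearMap.id := by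
  intro t
  induction t with
  | zero => simp
  | tmul x y => rfl
  | add s t hs ht => simp_all

theorem isCoalgBilin_mul : IsCoalgBilin (LinearMap.mul k B) where
  comul_apply a b n m u v u' v' h h' := by
    have := Bialgebra.comul_mul (R := k) a b
    rw [h, h', Finset.sum_mul_sum] at this
    simpa using this
  counit_apply := Bialgebra.counit_mul

/-- Over the base `k` the projection is the identity, so the identity serves as section.
Cocommutativity is needed only for the bijectivity of the antipode, through `S² = id`. -/
theorem isHopfAlgebroid_ofHopfAlgebra [IsCocomm k B] :
    (HopfAlgebroidData.ofHopfAlgebra k B).IsHopfAlgebroid where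
  mul_assoc := mul_assoc
  one_mul := one_mul
  mul_one := mul_one
  src_one := map_one (algebraMap k B)
  src_mul := map_mul (algebraMap k B)
  smul_eq f x := Algebra.smul_def f x
  coassoc x := coassoc_apply x
  comul_mul_src x f n u v h := by
    simp [HopfAlgebroidData.ofHopfAlgebra, ← Algebra.commutes, ← Algebra.smul_def,
      TensorProduct.smul_tmul']
  comul_one := Bialgebra.comul_one
  comul_mul := isCoalgBilin_mul.comul_apply
  counit_one := Bialgebra.counit_one
  counit_mul x y := by simp [HopfAlgebroidData.ofHopfAlgebra]
  counit_left x n u v h := Represents.sum_counit_smul h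
  counit_right x n u v h := Represents.sum_counit_smul' h
  antipode_bijective := (show Function.Involutive (HopfAlgebra.antipode k (A := B)) from
    antipode_antipode_of_isCocomm).bijective
  antipode_one := HopfAlgebra.antipode_one
  antipode_mul := HopfAlgebra.antipode_mul_antidistrib
  antipode_src f := by
    simp [HopfAlgebroidData.ofHopfAlgebra, Algebra.algebraMap_eq_smul_one]
  antipode_left x n u v h := by
    simpa [HopfAlgebroidData.ofHopfAlgebra] using Represents.sum_antipode_mul h
  antipode_right := ⟨LinearMap.id, isProjSection_id, fun x => by
    obtain ⟨n, u, v, h⟩ := exists_represents (comul (R := k) x)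
    exact (h.map_lift ((LinearMap.mul k B).compl₂ (HopfAlgebra.antipode k))).trans
      h.sum_mul_antipode⟩

/-- The axioms of a module algebra over a Hopf algebra. -/
structure IsHopfModuleAlgebra (act : B →ₗ[k] R →ₗ[k] R) : Prop extends IsMeasuring act where
  one_act : ∀ f, act 1 f = f
  mul_act : ∀ a b f, act (a * b) f = act a (act b f)

theorem IsHopfModuleAlgebra.of_ofHopfAlgebra {act : B →ₗ[k] R →ₗ[k] R}
    (h : (HopfAlgebroidData.ofHopfAlgebra k B).IsModuleAlgebra act) :
    IsHopfModuleAlgebra act where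
  act_mul a f g n u v huv := h.act_mul a f g n u v huv
  act_one a := (h.act_one a).trans (Algebra.algebraMap_eq_smul_one _).symm
  one_act := h.one_act
  mul_act := h.mul_act

/-- The product of the smash product `R # B`. -/
noncomputable abbrev smashMul (act : B →ₗ[k] R →ₗ[k] R) :
    R ⊗[k] B →ₗ[R] (R ⊗[k] B →ₗ[k] R ⊗[k] B) := twistMul act (LinearMap.mul k B)

/-- The antipode of the smash product `R # B`. -/
noncomputable abbrev smashAntipode (act : B →ₗ[k] R →ₗ[k] R) : R ⊗[k] B →ₗ[k] R ⊗[k] B :=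
  (smashProduct (HopfAlgebroidData.ofHopfAlgebra k B) act).antipode

variable {act : B →ₗ[k] R →ₗ[k] R}

theorem smashProduct_mul_apply (x y : R ⊗[k] B) :
    (smashProduct (HopfAlgebroidData.ofHopfAlgebra k B) act).mul x y = smashMul act x y := by
  induction x with
  | zero => simp
  | add x x' hx hx' => simp only [map_add, LinearMap.add_apply, hx, hx']
  | tmul f a => rfl

theorem smashProduct_comul_apply (x : R ⊗[k] B) :
    (smashProduct (HopfAlgebroidData.ofHopfAlgebra k B) act).comul x = comul (R := R) x := by
  induction x with
  | zero => simp
  | add x x' hx hx' => simp only [map_add, hx, hx']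
  | tmul f a =>
    obtain ⟨n, u, v, h⟩ := exists_represents (comul (R := k) a)
    rw [comul_tmul_of_represents h]
    exact smashProduct_comul (HopfAlgebroidData.ofHopfAlgebra k B) act h f

theorem smashProduct_counit_apply (x : R ⊗[k] B) :
    (smashProduct (HopfAlgebroidData.ofHopfAlgebra k B) act).counit x = counit (R := R) x := by
  induction x with
  | zero => simp
  | add x x' hx hx' => simp only [map_add, hx, hx']
  | tmul f a =>
    rw [smashProduct_counit, TensorProduct.counit_tmul, Algebra.smul_def, mul_comm]
    rfl

theorem twist_one (hact : IsHopfModuleAlgebra act) (x : R ⊗[k] B) :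
    twist act (LinearMap.mul k B) 1 x = x := by
  induction x with
  | zero => simp
  | add x x' hx hx' => simp only [map_add, hx, hx']
  | tmul f a =>
    have h : Represents (comul (R := k) (1 : B)) (fun _ : Fin 1 => 1) (fun _ => 1) := by
      simp [Represents, Algebra.TensorProduct.one_def]
    simp [twist_tmul act _ h, hact.one_act]

theorem twist_mul (hact : IsHopfModuleAlgebra act) (a b : B) (x : R ⊗[k] B) :
    twist act (LinearMap.mul k B) (a * b) x =
      twist act (LinearMap.mul k B) a (twist act (LinearMap.mul k B) b x) :=
  twist_apply_apply (m := LinearMap.mul k B) isCoalgBilin_mul hact.mul_act mul_assoc a b x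

theorem twist_algebraMap (hact : IsHopfModuleAlgebra act) (c : k) (x : R ⊗[k] B) :
    twist act (LinearMap.mul k B) (algebraMap k B c) x = c • x := by
  rw [Algebra.algebraMap_eq_smul_one, map_smul, LinearMap.smul_apply, twist_one hact]

/-- On `fa` and `gb`, both sides are `f (a₁ ⇀ g)` times the action of `a₂ b` on `z`: one side uses
the module algebra axiom through `twist_smul`, the other the action property `twist_mul`. -/
theorem smashMul_assoc (hact : IsHopfModuleAlgebra act) (x y z : R ⊗[k] B) :
    smashMul act (smashMul act x y) z = smashMul act x (smashMul act y z) := by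
  induction x with
  | zero => simp
  | add x x' hx hx' => simp only [map_add, LinearMap.add_apply, hx, hx']
  | tmul f a =>
  induction y with
  | zero => simp
  | add x x' hx hx' => simp only [map_add, LinearMap.add_apply, hx, hx']
  | tmul g b =>
    obtain ⟨n, u, v, h⟩ := exists_represents (comul (R := k) a)
    simp only [twistMul_tmul, twist_smul hact.toIsMeasuring h, map_smul, LinearMap.smul_apply]
    simp [twist_tmul act _ h, twistMul_tmul, twist_mul hact]

theorem smashMul_tmul_one (hact : IsHopfModuleAlgebra act) (f : R) (x : R ⊗[k] B) :
    smashMul act (f ⊗ₜ 1) x = f • x := by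
  rw [twistMul_tmul, twist_one hact]

theorem smashMul_one (hact : IsHopfModuleAlgebra act) (x : R ⊗[k] B) :
    smashMul act x (1 ⊗ₜ 1) = x := by
  induction x with
  | zero => simp
  | add x x' hx hx' => simp only [map_add, LinearMap.add_apply, hx, hx']
  | tmul f a =>
    simp [twistMul_tmul, twist_one_tmul hact.toIsMeasuring, TensorProduct.smul_tmul']

/-! ### The antipode of the smash product -/

section Antipode

variable [IsCocomm k B]

/-- Since `Δ(S(a)) = S(a₁) ⊗ S(a₂)` by cocommutativity, `(S(a₁) ⇀ f) S(a₂)` is the product `S(a) ·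
f` in `R # B`. -/
theorem smashAntipode_tmul (f : R) (a : B) : smashAntipode act (f ⊗ₜ a) =
    twist act (LinearMap.mul k B) (HopfAlgebra.antipode k a) (f ⊗ₜ 1) := by
  obtain ⟨n, u, v, h⟩ := exists_represents (comul (R := k) a)
  rw [twist_tmul act _ h.antipode]
  simp only [LinearMap.mul_apply', mul_one]
  exact smashProduct_antipode (HopfAlgebroidData.ofHopfAlgebra k B) act h f

theorem smashAntipode_tmul_one (hact : IsHopfModuleAlgebra act) (f : R) :
    smashAntipode act (f ⊗ₜ 1) = f ⊗ₜ 1 := by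
  rw [smashAntipode_tmul, HopfAlgebra.antipode_one, twist_one hact]

theorem smashAntipode_smul (hact : IsHopfModuleAlgebra act) (f : R) (y : R ⊗[k] B) :
    smashAntipode act (f • y) = smashMul act (smashAntipode act y) (f ⊗ₜ 1) := by
  induction y with
  | zero => simp
  | add x x' hx hx' => simp only [smul_add, map_add, LinearMap.add_apply, hx, hx']
  | tmul g a =>
    rw [TensorProduct.smul_tmul', smashAntipode_tmul, smashAntipode_tmul,
      ← one_smul R (twist act _ _ (g ⊗ₜ 1)), ← twistMul_tmul, smashMul_assoc hact,
      smashMul_tmul_one hact, twistMul_tmul, one_smul, TensorProduct.smul_tmul', smul_eq_mul,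
      smul_eq_mul, mul_comm]

/-- The commutation rule `S(a₂) · (a₁ ⇀ g) = g S(a)`: the left side is `(S(a₂) a₁ ⇀ g) S(a₃)`, and
cocommutativity brings `S(a₂)` and `a₁` into the order in which they cancel. -/
theorem sum_twist_antipode_act (hact : IsHopfModuleAlgebra act) {a : B} {n : ℕ} {u v : Fin n → B}
    (h : Represents (comul (R := k) a) u v) (g : R) :
    ∑ i, twist act (LinearMap.mul k B) (HopfAlgebra.antipode k (v i)) (act (u i) g ⊗ₜ 1) =
      g ⊗ₜ HopfAlgebra.antipode k a := by
  choose m p q hpq using fun i => exists_represents (comul (R := k) (u i))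
  choose l r s hrs using fun i => exists_represents (comul (R := k) (v i))
  have := h.sum_coassoc_swap hpq hrs
    (fun x y z => act (HopfAlgebra.antipode k x * y) g ⊗ₜ[k] HopfAlgebra.antipode k z)
    (fun _ _ => by constructor <;>
      simp [add_mul, TensorProduct.add_tmul, TensorProduct.smul_tmul'])
    (fun _ _ => by constructor <;>
      simp [mul_add, TensorProduct.add_tmul, TensorProduct.smul_tmul'])
    (fun _ _ => by constructor <;> simp [TensorProduct.tmul_add])
  simp only [fun i => twist_tmul act (LinearMap.mul k B) (hrs i).antipode, ← hact.mul_act,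
    LinearMap.mul_apply', mul_one, ← this]
  simp only [← TensorProduct.sum_tmul, ← LinearMap.sum_apply, ← map_sum,
    fun i => (hpq i).sum_antipode_mul]
  conv_rhs => rw [← h.sum_counit_smul]
  simp [Algebra.algebraMap_eq_smul_one, hact.one_act, TensorProduct.tmul_sum,
    TensorProduct.smul_tmul']

/-- For `y = gb`, `θ((a₁ ⇀ g) a₂ b) = S(b) S(a₂) · (a₁ ⇀ g) = S(b) · g S(a) = θ(gb) S(a)`, the
middle step being `sum_twist_antipode_act`. -/
theorem smashAntipode_twist (hact : IsHopfModuleAlgebra act) (a : B) (y : R ⊗[k] B) :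
    smashAntipode act (twist act (LinearMap.mul k B) a y) =
      smashMul act (smashAntipode act y) (1 ⊗ₜ HopfAlgebra.antipode k a) := by
  induction y with
  | zero => simp
  | add x x' hx hx' => simp only [map_add, LinearMap.add_apply, hx, hx']
  | tmul g b =>
    obtain ⟨n, u, v, h⟩ := exists_represents (comul (R := k) a)
    have key := sum_twist_antipode_act hact h g
    rw [twist_tmul act _ h, map_sum]
    simp only [smashAntipode_tmul, LinearMap.mul_apply', HopfAlgebra.antipode_mul_antidistrib,
      twist_mul hact]
    rw [← map_sum, key, ← one_smul R (twist act _ _ (g ⊗ₜ 1)), ← twistMul_tmul,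
      smashMul_assoc hact, smashMul_tmul_one hact, twistMul_tmul, one_smul,
      TensorProduct.smul_tmul', smul_eq_mul, mul_one]

theorem smashAntipode_mul (hact : IsHopfModuleAlgebra act) (x y : R ⊗[k] B) :
    smashAntipode act (smashMul act x y) =
      smashMul act (smashAntipode act y) (smashAntipode act x) := by
  induction x with
  | zero => simp
  | add x x' hx hx' => simp only [map_add, LinearMap.add_apply, hx, hx']
  | tmul f a =>
    rw [twistMul_tmul, smashAntipode_smul hact, smashAntipode_twist hact, smashMul_assoc hact,
      twistMul_tmul act _ 1, one_smul, ← smashAntipode_tmul]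

theorem smashAntipode_smashAntipode (hact : IsHopfModuleAlgebra act) (x : R ⊗[k] B) :
    smashAntipode act (smashAntipode act x) = x := by
  induction x with
  | zero => simp
  | add x x' hx hx' => simp only [map_add, hx, hx']
  | tmul f a =>
    rw [smashAntipode_tmul, smashAntipode_twist hact, smashAntipode_tmul_one hact,
      smashMul_tmul_one hact, antipode_antipode_of_isCocomm, TensorProduct.smul_tmul', smul_eq_mul,
      mul_one]

theorem sum_smashMul_smashAntipode (hact : IsHopfModuleAlgebra act) {a : B} {n : ℕ}
    {u v : Fin n → B} (h : Represents (comul (R := k) a) u v) (f g : R) :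
    ∑ i, smashMul act (f ⊗ₜ u i) (smashAntipode act (g ⊗ₜ v i)) =
      (f * g * algebraMap k R (counit a)) ⊗ₜ 1 := by
  simp only [twistMul_tmul, smashAntipode_tmul, ← twist_mul hact]
  rw [← Finset.smul_sum, ← LinearMap.sum_apply, ← map_sum, h.sum_mul_antipode,
    twist_algebraMap hact]
  simp [Algebra.smul_def, mul_comm, mul_assoc]

/-- As `θ(fga) = S(a) · fg`, its coproduct is `S(a₁) · fg ⊗ S(a₂) · 1`; then `sum_twist_smul_tmul`
moves `g` to the second leg. -/
theorem comul_smashAntipode (hact : IsHopfModuleAlgebra act) {a : B} {n : ℕ}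
    {u v : Fin n → B} (h : Represents (comul (R := k) a) u v) (f g : R) :
    comul (R := R) (smashAntipode act ((f * g) ⊗ₜ a)) =
      ∑ i, smashAntipode act (f ⊗ₜ u i) ⊗ₜ[R] smashAntipode act (g ⊗ₜ v i) := by
  have h1 : Represents (comul (R := k) (1 : B)) (fun _ : Fin 1 => 1) (fun _ => 1) := by
    simp [Represents, Algebra.TensorProduct.one_def]
  rw [smashAntipode_tmul, comul_twist hact.toIsMeasuring isCoalgBilin_mul h.antipode
    (represents_comul_tmul h1 (f * g))]
  have := sum_twist_smul_tmul hact.toIsMeasuring (φ := LinearMap.mul k B) h.antipode g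
    (f ⊗ₜ 1) (1 ⊗ₜ 1)
  simp only [TensorProduct.smul_tmul', smul_eq_mul, mul_one] at this
  simpa [smashAntipode_tmul, mul_comm f g] using this

/-- The expression is balanced because `θ(gs) t = θ(s) ι(g) t`. On `fa` it is `S(a₁) f a₂ = (S(a₁) ⇀
f) S(a₂) a₃ = S(a) ⇀ f`, which is also `ε(θ(fa))`. -/
theorem sum_smashAntipode_smashMul (hact : IsHopfModuleAlgebra act) {x : R ⊗[k] B} {n : ℕ}
    {u v : Fin n → R ⊗[k] B} (h : Represents (comul (R := R) x) u v) :
    ∑ i, smashMul act (smashAntipode act (u i)) (v i) =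
      counit (R := R) (smashAntipode act x) ⊗ₜ 1 := by
  refine h.sum_balanced (fun s t => smashMul act (smashAntipode act s) t)
    (fun _ _ _ => by simp) (fun _ _ _ => by simp)
    (fun g s t => by rw [smashAntipode_smul hact, smashMul_assoc hact, smashMul_tmul_one hact])
    ((TensorProduct.mk k R B).flip 1 ∘ₗ (counit (R := R) (A := R ⊗[k] B)).restrictScalars k ∘ₗ
      smashAntipode act).toAddMonoidHom ?_
  intro f a n u v h
  simp only [LinearMap.toAddMonoidHom_coe, LinearMap.comp_apply, LinearMap.flip_apply,
    LinearMap.restrictScalars_apply, TensorProduct.mk_apply]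
  rw [smashAntipode_tmul, counit_twist isCoalgBilin_mul]
  have key (i) : smashMul act (smashAntipode act (f ⊗ₜ u i)) (1 ⊗ₜ v i) =
      twist act (LinearMap.mul k B) (HopfAlgebra.antipode k (u i)) (f ⊗ₜ v i) := by
    rw [smashAntipode_tmul, ← one_smul R (twist act _ _ (f ⊗ₜ 1)), ← twistMul_tmul,
      smashMul_assoc hact, smashMul_tmul_one hact, twistMul_tmul, one_smul,
      TensorProduct.smul_tmul', smul_eq_mul, mul_one]
  simp only [key]
  choose m p q hpq using fun i => exists_represents (comul (R := k) (u i))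
  choose l r s hrs using fun i => exists_represents (comul (R := k) (v i))
  have := h.sum_coassoc hpq hrs
    (fun x y z => act (HopfAlgebra.antipode k x) f ⊗ₜ[k] (HopfAlgebra.antipode k y * z))
    (fun _ _ => by constructor <;> simp [TensorProduct.add_tmul, TensorProduct.smul_tmul'])
    (fun _ _ => by constructor <;> simp [add_mul, TensorProduct.tmul_add])
    (fun _ _ => by constructor <;> simp [mul_add, TensorProduct.tmul_add])
  simp only [fun i => twist_tmul act (LinearMap.mul k B) (hpq i).antipode, LinearMap.mul_apply',
    this]
  simp only [← TensorProduct.tmul_sum, fun i => (hrs i).sum_antipode_mul]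
  conv_rhs => rw [← h.sum_counit_smul']
  simp [Algebra.algebraMap_eq_smul_one, TensorProduct.sum_tmul, TensorProduct.smul_tmul']

end Antipode

end Hopf


/-! ### An explicit section of `H ⊗ H → H ⊗_R H` -/

section FreeSection

open Coalgebra

variable {k R B : Type*} [CommRing k] [CommRing R] [Algebra k R] [AddCommGroup B] [Module k B]

variable (k R B) in
/-- The section `fa ⊗_R gb ↦ fg a ⊗ 1b` of the projection `H ⊗ H → H ⊗_R H` for `H = R ⊗ B`. -/
noncomputable def freeSection :
    (R ⊗[k] B) ⊗[R] (R ⊗[k] B) →ₗ[k] (R ⊗[k] B) ⊗[k] (R ⊗[k] B) :=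
  LinearMap.lTensor (R ⊗[k] B) (TensorProduct.mk k R B 1) ∘ₗ
    ((TensorProduct.AlgebraTensorModule.cancelBaseChange k R R (R ⊗[k] B)
      B).toLinearMap.restrictScalars k)

theorem freeSection_tmul (x : R ⊗[k] B) (g : R) (b : B) :
    freeSection k R B (x ⊗ₜ (g ⊗ₜ b)) = (g • x) ⊗ₜ (1 ⊗ₜ b) := by
  simp [freeSection]

theorem isProjSection_freeSection : IsProjSection (freeSection k R B) := by
  intro t
  induction t with
  | zero => simp
  | add s t hs ht => simp only [map_add, hs, ht]
  | tmul x y =>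
  induction y with
  | zero => simp
  | add s t hs ht => simp only [TensorProduct.tmul_add, map_add, hs, ht]
  | tmul g b =>
    rw [freeSection_tmul]
    simp [proj, TensorProduct.smul_tmul, TensorProduct.smul_tmul']

/-- The second legs of the standard presentation already have coefficient `1`, so the section
returns that presentation unchanged. The antipode identities read through it therefore reduce to
those on `fa₁ ⊗ 1a₂`. -/
theorem freeSection_comul_tmul [Coalgebra k B] {a : B} {n : ℕ} {u v : Fin n → B}
    (h : Represents (comul (R := k) a) u v) (f : R) :
    freeSection k R B (comul (R := R) (f ⊗ₜ[k] a)) =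
      ∑ i, (f ⊗ₜ[k] u i) ⊗ₜ[k] ((1 : R) ⊗ₜ[k] v i) := by
  rw [comul_tmul_of_represents h, map_sum]
  simp [freeSection_tmul]

end FreeSection

/-! ### The smash product is a Hopf algebroid -/

section Smash

open Coalgebra

variable {k R B : Type*} [CommRing k] [CommRing R] [Algebra k R] [Ring B] [HopfAlgebra k B]
  {act : B →ₗ[k] R →ₗ[k] R}

/-- For `x = fa`, both sides equal `f (a ⇀ ε(y))`. -/
theorem counit_smashMul (x y : R ⊗[k] B) :
    counit (R := R) (smashMul act x y) =
      counit (R := R) (smashMul act x (counit (R := R) y ⊗ₜ 1)) := by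
  induction x with
  | zero => simp
  | add x x' hx hx' => simp only [map_add, LinearMap.add_apply, hx, hx']
  | tmul f a =>
    simp [twistMul_tmul, counit_twist isCoalgBilin_mul]

variable [IsCocomm k B]

theorem lift_smashAntipode_freeSection (hact : IsHopfModuleAlgebra act) (x : R ⊗[k] B) :
    TensorProduct.lift ((smashProduct (HopfAlgebroidData.ofHopfAlgebra k B) act).mul.compl₂
      (smashAntipode act)) (freeSection k R B (comul (R := R) x)) =
      counit (R := R) x ⊗ₜ 1 := by
  induction x with
  | zero => simp
  | add x x' hx hx' => simp only [map_add, TensorProduct.add_tmul, hx, hx']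
  | tmul f a =>
    obtain ⟨n, u, v, h⟩ := exists_represents (comul (R := k) a)
    rw [freeSection_comul_tmul h, map_sum]
    simp only [TensorProduct.lift.tmul, LinearMap.compl₂_apply, smashProduct_mul_apply]
    rw [sum_smashMul_smashAntipode hact h]
    simp [Algebra.smul_def, mul_comm]

theorem proj_map_smashAntipode_freeSection (hact : IsHopfModuleAlgebra act) (x : R ⊗[k] B) :
    comul (R := R) (smashAntipode act x) = proj k R (R ⊗[k] B)
      (TensorProduct.map (smashAntipode act) (smashAntipode act)
        (freeSection k R B (comul (R := R) x))) := by
  induction x with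
  | zero => simp
  | add x x' hx hx' => simp only [map_add, hx, hx']
  | tmul f a =>
    obtain ⟨n, u, v, h⟩ := exists_represents (comul (R := k) a)
    rw [freeSection_comul_tmul h, ← mul_one f, comul_smashAntipode hact h, map_sum, map_sum]
    simp [proj]

theorem isHopfAlgebroid_smashProduct (hact : IsHopfModuleAlgebra act) :
    (smashProduct (HopfAlgebroidData.ofHopfAlgebra k B) act).IsHopfAlgebroid where
  mul_assoc x y z := by simp only [smashProduct_mul_apply, smashMul_assoc hact]
  one_mul x := by
    rw [smashProduct_mul_apply]
    exact (smashMul_tmul_one hact 1 x).trans (one_smul R x)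
  mul_one x := by
    rw [smashProduct_mul_apply]
    exact smashMul_one hact x
  src_one := rfl
  src_mul f g := by
    rw [smashProduct_mul_apply]
    exact (smashMul_tmul_one hact f (g ⊗ₜ 1)).symm
  smul_eq f x := by
    rw [smashProduct_mul_apply]
    exact (smashMul_tmul_one hact f x).symm
  coassoc x := by
    have h : (smashProduct (HopfAlgebroidData.ofHopfAlgebra k B) act).comul =
      comul (R := R) := LinearMap.ext smashProduct_comul_apply
    rw [h]
    exact coassoc_apply x
  comul_mul_src x f n u v h := by
    rw [smashProduct_comul_apply] at h
    simp only [smashProduct_mul_apply]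
    -- Moving `f` between the legs with both right factors equal to `1` is exactly the required
    -- condition, since `f • 1 = ι(f)`.
    have := sum_twistMul_smul_tmul (φ := LinearMap.mul k B) hact.toIsMeasuring h f
      (1 ⊗ₜ 1) (1 ⊗ₜ 1)
    simp only [TensorProduct.smul_tmul', smul_eq_mul, mul_one, smashMul_one hact] at this
    exact this
  comul_one := by
    rw [smashProduct_comul_apply]
    exact Bialgebra.comul_one
  comul_mul x y n m u v u' v' h h' := by
    rw [smashProduct_comul_apply] at h h' ⊢
    simp only [smashProduct_mul_apply]
    exact comul_twistMul hact.toIsMeasuring isCoalgBilin_mul h h'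
  counit_one := by
    rw [smashProduct_counit_apply]
    exact Bialgebra.counit_one
  counit_mul x y := by
    rw [map_sub, map_sub, sub_eq_zero]
    simp only [smashProduct_counit_apply, smashProduct_mul_apply]
    exact counit_smashMul x y
  counit_left x n u v h := by
    rw [smashProduct_comul_apply] at h
    simp only [smashProduct_counit_apply]
    exact h.sum_counit_smul
  counit_right x n u v h := by
    rw [smashProduct_comul_apply] at h
    simp only [smashProduct_counit_apply]
    exact h.sum_counit_smul'
  antipode_bijective := (show Function.Involutive (smashAntipode act) from
    smashAntipode_smashAntipode hact).bijective
  antipode_one := smashAntipode_tmul_one hact 1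
  antipode_mul x y := by
    simp only [smashProduct_mul_apply]
    exact smashAntipode_mul hact x y
  antipode_src f := smashAntipode_tmul_one hact f
  antipode_left x n u v h := by
    rw [smashProduct_comul_apply] at h
    simp only [smashProduct_mul_apply, smashProduct_counit_apply]
    exact sum_smashAntipode_smashMul hact h
  antipode_right := ⟨freeSection k R B, isProjSection_freeSection, fun x => by
    rw [smashProduct_comul_apply, smashProduct_counit_apply]
    exact lift_smashAntipode_freeSection hact x⟩

end Smash


/-! ### The sub-adjacent Hopf algebra of a post-Hopf algebra -/

section SubAdjacent

open Coalgebra LinearMap WithConv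

theorem represents_comul_tmul_tmul {k A B : Type*} [CommRing k] [AddCommGroup A] [Module k A]
    [Coalgebra k A] [AddCommGroup B] [Module k B] [Coalgebra k B] {a : A} {b : B} {n m : ℕ}
    {u v : Fin n → A} {u' v' : Fin m → B}
    (h : Represents (comul (R := k) a) u v) (h' : Represents (comul (R := k) b) u' v') :
    comul (R := k) (a ⊗ₜ[k] b) = ∑ i, ∑ j, (u i ⊗ₜ[k] u' j) ⊗ₜ[k] (v i ⊗ₜ[k] v' j) := by
  simp only [Represents] at h h'
  rw [TensorProduct.comul_tmul, h, h']
  simp [TensorProduct.tmul_sum, TensorProduct.sum_tmul]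
  exact Finset.sum_comm

theorem isCoalgBilin_curry {k A : Type*} [CommRing k] [AddCommGroup A] [Module k A]
    [Coalgebra k A] (f : A ⊗[k] A →ₗc[k] A) :
    IsCoalgBilin (TensorProduct.curry f.toLinearMap) where
  comul_apply a b n m u v u' v' h h' := by
    have := CoalgHomClass.map_comp_comul_apply f (a ⊗ₜ[k] b)
    rw [represents_comul_tmul_tmul h h'] at this
    simpa using this.symm
  counit_apply a b := by
    have := CoalgHomClass.counit_comp_apply f (a ⊗ₜ[k] b)
    rwa [TensorProduct.counit_tmul, smul_eq_mul, mul_comm] at this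

variable {k A : Type*} [CommRing k] [Ring A] [HopfAlgebra k A]

theorem End_convMul_apply {a : A} {n : ℕ} {u v : Fin n → A}
    (h : Represents (comul (R := k) a) u v) (f g : WithConv (A →ₗ[k] Module.End k A)) (y : A) :
    (f * g).ofConv a y = ∑ i, f.ofConv (u i) (g.ofConv (v i) y) := by
  simp only [Represents] at h
  simp [LinearMap.convMul_def, h]

namespace PostHopfAlgebra

variable (P : PostHopfAlgebra k A)

/-- The product `*_▷` of the sub-adjacent Hopf algebra. -/
noncomputable abbrev gl : A →ₗ[k] A →ₗ[k] A :=
  grossmanLarsonMul (TensorProduct.curry P.tri.toLinearMap)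

variable {P} {a : A} {n : ℕ} {u v : Fin n → A}

theorem gl_apply (h : Represents (comul (R := k) a) u v) (y : A) :
    P.gl a y = ∑ i, u i * P.tri (v i ⊗ₜ y) :=
  grossmanLarsonMul_apply _ h y

theorem tri_gl (x y z : A) : P.tri (P.gl x y ⊗ₜ z) = P.tri (x ⊗ₜ P.tri (y ⊗ₜ z)) := by
  obtain ⟨n, u, v, h⟩ := exists_represents (comul (R := k) x)
  rw [P.tri_tri x y z n u v h, gl_apply h, TensorProduct.sum_tmul, map_sum]

theorem comul_tri (h : Represents (comul (R := k) a) u v) {b : A} {m : ℕ} {u' v' : Fin m → A}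
    (h' : Represents (comul (R := k) b) u' v') : comul (R := k) (P.tri (a ⊗ₜ b)) =
      ∑ i, ∑ j, P.tri (u i ⊗ₜ u' j) ⊗ₜ[k] P.tri (v i ⊗ₜ v' j) :=
  (isCoalgBilin_curry P.tri).comul_apply _ _ _ _ _ _ _ _ h h'

theorem counit_tri (a b : A) :
    counit (R := k) (P.tri (a ⊗ₜ b)) = counit (R := k) a * counit (R := k) b :=
  (isCoalgBilin_curry P.tri).counit_apply a b

theorem represents_one : Represents (comul (R := k) (1 : A)) (fun _ : Fin 1 => 1) (fun _ => 1) := by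
  simp [Represents, Algebra.TensorProduct.one_def]

/-- The map `φ = (· ▷ 1)` is a convolution idempotent because `1 · 1 = 1`. It is also a coalgebra
map, so `S ∘ φ` is a left convolution inverse. An idempotent with a left inverse is the unit. -/
theorem tri_one (x : A) : P.tri (x ⊗ₜ 1) = algebraMap k A (counit x) := by
  let φ : WithConv (A →ₗ[k] A) := toConv ((TensorProduct.curry P.tri.toLinearMap).flip 1)
  have hφ (x) : φ.ofConv x = P.tri (x ⊗ₜ 1) := rfl
  have mul_ofConv (f g : WithConv (A →ₗ[k] A)) {x : A} {n : ℕ} {u v : Fin n → A}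
      (h : Represents (comul (R := k) x) u v) :
      (f * g).ofConv x = ∑ i, f.ofConv (u i) * g.ofConv (v i) := by
    simp only [Represents] at h
    simp [LinearMap.convMul_def, h]
  have h1 : φ * φ = φ := by
    apply WithConv.ext
    ext x
    obtain ⟨n, u, v, h⟩ := exists_represents (comul (R := k) x)
    have h' := P.tri_mul x 1 1 n u v h
    rw [mul_one] at h'
    rw [mul_ofConv _ _ h]
    exact h'.symm
  have h2 : toConv (HopfAlgebra.antipode k ∘ₗ φ.ofConv) * φ = 1 := by
    apply WithConv.ext
    ext x
    obtain ⟨n, u, v, h⟩ := exists_represents (comul (R := k) x)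
    have h3 : Represents (comul (R := k) (P.tri (x ⊗ₜ 1))) (fun i => P.tri (u i ⊗ₜ 1))
        (fun i => P.tri (v i ⊗ₜ 1)) := by
      rw [Represents, comul_tri h represents_one]
      simp
    rw [mul_ofConv _ _ h]
    refine h3.sum_antipode_mul.trans ?_
    rw [counit_tri, Bialgebra.counit_one, mul_one]
    rfl
  have h3 : φ = 1 := by rw [← h2, ← h1, ← mul_assoc, h1, h2, one_mul]
  rw [← hφ, h3]
  rfl

/-- Since `1 ▷ 1 = 1`, the operator `α₁` is idempotent; it has the left inverse `β₁`, so it is the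
identity. -/
theorem one_tri (y : A) : P.tri (1 ⊗ₜ y) = y := by
  have h1 := P.beta_alpha 1 (P.tri (1 ⊗ₜ y)) 1 _ _ represents_one
  have h2 := P.beta_alpha 1 y 1 _ _ represents_one
  have h3 := P.tri_tri 1 1 y 1 _ _ represents_one
  simp [tri_one] at h1 h2 h3
  rw [← h1, h3, h2]

theorem gl_one (x : A) : P.gl x 1 = x := by
  obtain ⟨n, u, v, h⟩ := exists_represents (comul (R := k) x)
  rw [gl_apply h]
  simp only [tri_one, ← Algebra.commutes, ← Algebra.smul_def]
  exact h.sum_counit_smul'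

theorem one_gl (x : A) : P.gl 1 x = x := by
  rw [gl_apply represents_one]
  simp [one_tri]

theorem algebraMap_gl (c : k) (x : A) : P.gl (algebraMap k A c) x = c • x := by
  rw [Algebra.algebraMap_eq_smul_one, map_smul, LinearMap.smul_apply, one_gl]

theorem gl_algebraMap (c : k) (x : A) : P.gl x (algebraMap k A c) = c • x := by
  rw [Algebra.algebraMap_eq_smul_one, map_smul, gl_one]

/-- `*_▷` is the composite `m ∘ (id ⊗ ▷) ∘ (Δ ⊗ id)` of coalgebra maps; cocommutativity is what
makes `Δ` one of them. -/
theorem isCoalgBilin_gl [IsCocomm k A] : IsCoalgBilin P.gl := by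
  let f : A ⊗[k] A →ₗc[k] A := (Bialgebra.mulCoalgHom k A).comp
    ((Coalgebra.TensorProduct.map (CoalgHom.id k A) P.tri).comp
      (((Coalgebra.TensorProduct.assoc k k A A A : _ ≃ₗc[k] _) :
        (A ⊗[k] A) ⊗[k] A →ₗc[k] A ⊗[k] (A ⊗[k] A)).comp
        (Coalgebra.TensorProduct.map (comulCoalgHom k A) (CoalgHom.id k A))))
  have : P.gl = TensorProduct.curry f.toLinearMap := by
    ext x y
    obtain ⟨n, u, v, h⟩ := exists_represents (comul (R := k) x)
    rw [gl_apply h]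
    have h2 : f (x ⊗ₜ y) = LinearMap.mul' k A (TensorProduct.map LinearMap.id P.tri.toLinearMap
      (TensorProduct.assoc k A A A (comul (R := k) x ⊗ₜ y))) := rfl
    refine Eq.trans ?_ h2.symm
    rw [h]
    simp [TensorProduct.sum_tmul]
  rw [this]
  exact isCoalgBilin_curry f

/-- Both sides equal `x₁ (x₂ ▷ y₁) (x₃ ▷ (y₂ ▷ z))`: on the left by multiplicativity of the
coproduct for `*_▷` and `tri_gl`, on the right because `x₂ ▷ ·` is multiplicative. -/
theorem gl_assoc [IsCocomm k A] (x y z : A) : P.gl (P.gl x y) z = P.gl x (P.gl y z) := by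
  obtain ⟨n, u, v, h⟩ := exists_represents (comul (R := k) x)
  obtain ⟨n', u', v', h'⟩ := exists_represents (comul (R := k) y)
  choose m p q hpq using fun i => exists_represents (comul (R := k) (u i))
  choose l r s hrs using fun i => exists_represents (comul (R := k) (v i))
  have h1 := isCoalgBilin_gl (P := P).comul_apply _ _ _ _ _ _ _ _ h h'
  have h2 : P.gl (P.gl x y) z = ∑ i, ∑ j, P.gl (u i) (u' j) * P.tri (P.gl (v i) (v' j) ⊗ₜ z) := by
    have h2 (w : A) : P.gl w z = TensorProduct.lift ((LinearMap.mul k A).compl₂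
      ((TensorProduct.curry P.tri.toLinearMap).flip z)) (comul (R := k) w) := rfl
    rw [h2, h1]
    simp
  have := h.sum_coassoc hpq hrs
    (fun a b c => ∑ j, a * P.tri (b ⊗ₜ u' j) * P.tri (c ⊗ₜ P.tri (v' j ⊗ₜ z)))
    (fun _ _ => by constructor <;> simp [add_mul, Finset.sum_add_distrib, Finset.smul_sum])
    (fun _ _ => by
      constructor <;>
      simp [mul_add, add_mul, TensorProduct.add_tmul, Finset.sum_add_distrib, Finset.smul_sum,
        ← TensorProduct.smul_tmul'])
    (fun _ _ => by
      constructor <;>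
      simp [mul_add, TensorProduct.add_tmul, Finset.sum_add_distrib, Finset.smul_sum,
        ← TensorProduct.smul_tmul'])
  rw [h2, gl_apply h, gl_apply h']
  simp only [tri_gl, fun i => gl_apply (P := P) (hpq i), TensorProduct.tmul_sum, map_sum,
    fun i y z => P.tri_mul _ y z _ _ _ (hrs i), Finset.mul_sum, Finset.sum_mul]
  calc _ = ∑ i, ∑ j, ∑ j', p i j * P.tri (q i j ⊗ₜ u' j') *
        P.tri (v i ⊗ₜ P.tri (v' j' ⊗ₜ z)) := Finset.sum_congr rfl fun i _ => Finset.sum_comm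
    _ = _ := this
    _ = _ := by
      refine Finset.sum_congr rfl fun i _ => ?_
      rw [Finset.sum_comm]
      simp only [mul_assoc]

/-- Recovers the original product from `*_▷`: `x₁ (x₂ ▷ β_{x₃}(y)) = x y`, as `α` and `β` cancel. -/
theorem sum_gl_beta (h : Represents (comul (R := k) a) u v) (y : A) :
    ∑ i, P.gl (u i) (P.beta (v i) y) = a * y := by
  choose m p q hpq using fun i => exists_represents (comul (R := k) (u i))
  choose l r s hrs using fun i => exists_represents (comul (R := k) (v i))
  have := h.sum_coassoc hpq hrs (fun a b c => a * P.tri (b ⊗ₜ P.beta c y))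
    (fun _ _ => by constructor <;> simp [add_mul])
    (fun _ _ => by
      constructor <;> simp [mul_add, TensorProduct.add_tmul, ← TensorProduct.smul_tmul'])
    (fun _ _ => by constructor <;> simp [mul_add, TensorProduct.tmul_add])
  simp only [fun i => gl_apply (P := P) (hpq i), this, ← Finset.mul_sum,
    fun i => P.alpha_beta _ y _ _ _ (hrs i)]
  conv_rhs => rw [← h.sum_counit_smul']
  simp [Finset.sum_mul]

/-- `x₁ *_▷ β_{x₂}(S(x₃)) = x₁ S(x₂)` by `sum_gl_beta`, which is `ε(x)`. -/
theorem sum_gl_antipode (h : Represents (comul (R := k) a) u v) :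
    ∑ i, P.gl (u i) (P.subAdjacent.antipode (v i)) = algebraMap k A (counit a) := by
  choose m p q hpq using fun i => exists_represents (comul (R := k) (u i))
  choose l r s hrs using fun i => exists_represents (comul (R := k) (v i))
  have := h.sum_coassoc hpq hrs (fun a b c => P.gl a (P.beta b (HopfAlgebra.antipode k c)))
    (fun _ _ => by constructor <;> simp)
    (fun _ _ => by constructor <;> simp)
    (fun _ _ => by constructor <;> simp)
  have h2 (i) : P.subAdjacent.antipode (v i) =
      ∑ j, P.beta (r i j) (HopfAlgebra.antipode k (s i j)) :=
    (hrs i).map_lift (P.beta.compl₂ (HopfAlgebra.antipode k))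
  simp only [h2, map_sum, ← this, fun i => sum_gl_beta (P := P) (hpq i)]
  exact h.sum_mul_antipode

/-- A direct computation is avoided by working in the convolution algebra `Hom(A, End A)`. There
`Λ`, left multiplication for `*_▷`, factors as `l * α` and so has the left inverse `β * l'`. By
`sum_gl_antipode` and associativity, `σ`, which is `Λ ∘ S_▷`, is a right inverse, hence two-sided.
-/
theorem sum_antipode_gl [IsCocomm k A] (h : Represents (comul (R := k) a) u v) :
    ∑ i, P.gl (P.subAdjacent.antipode (u i)) (v i) = algebraMap k A (counit a) := by
  let Λ : WithConv (A →ₗ[k] Module.End k A) := toConv P.gl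
  let l : WithConv (A →ₗ[k] Module.End k A) := toConv (LinearMap.mul k A)
  let l' : WithConv (A →ₗ[k] Module.End k A) :=
    toConv (LinearMap.mul k A ∘ₗ HopfAlgebra.antipode k)
  let α : WithConv (A →ₗ[k] Module.End k A) := toConv (TensorProduct.curry P.tri.toLinearMap)
  let β : WithConv (A →ₗ[k] Module.End k A) := toConv P.beta
  let σ : WithConv (A →ₗ[k] Module.End k A) := toConv (P.gl ∘ₗ P.subAdjacent.antipode)
  have one_ofConv (x y : A) : (1 : WithConv (A →ₗ[k] Module.End k A)).ofConv x y =
    counit (R := k) x • y := rfl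
  have hΛ : Λ = l * α := by
    apply WithConv.ext
    ext x y
    obtain ⟨n, u, v, h⟩ := exists_represents (comul (R := k) x)
    rw [End_convMul_apply h]
    exact gl_apply h y
  have hl : l' * l = 1 := by
    apply WithConv.ext
    ext x y
    obtain ⟨n, u, v, h⟩ := exists_represents (comul (R := k) x)
    rw [End_convMul_apply h, one_ofConv, Algebra.smul_def, ← h.sum_antipode_mul, Finset.sum_mul]
    exact Finset.sum_congr rfl fun i _ => (mul_assoc _ _ _).symm
  have hα : β * α = 1 := by
    apply WithConv.ext
    ext x y
    obtain ⟨n, u, v, h⟩ := exists_represents (comul (R := k) x)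
    rw [End_convMul_apply h, one_ofConv]
    exact P.beta_alpha x y _ _ _ h
  have hσ : Λ * σ = 1 := by
    apply WithConv.ext
    ext x y
    obtain ⟨n, u, v, h⟩ := exists_represents (comul (R := k) x)
    rw [End_convMul_apply h, one_ofConv]
    calc _ = P.gl (∑ i, P.gl (u i) (P.subAdjacent.antipode (v i))) y := by
          simp only [map_sum, LinearMap.sum_apply, gl_assoc]; rfl
      _ = _ := by
        rw [sum_gl_antipode h, Algebra.algebraMap_eq_smul_one, map_smul, LinearMap.smul_apply,
          one_gl]
  have hL : (β * l') * Λ = 1 := by rw [hΛ, mul_assoc, ← mul_assoc l', hl, one_mul, hα]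
  have hσ' : σ * Λ = 1 := by rw [← left_inv_eq_right_inv hL hσ, hL]
  -- Evaluating the operator identity at `1`, a right unit for `*_▷`, gives the antipode identity in
  -- `A`.
  have := congrArg (fun f : WithConv (A →ₗ[k] Module.End k A) => f.ofConv a 1) hσ'
  simp only [End_convMul_apply h, one_ofConv] at this
  rw [Algebra.algebraMap_eq_smul_one, ← this]
  exact Finset.sum_congr rfl fun i _ => congrArg _ (gl_one _).symm

end PostHopfAlgebra

/-- The type `A` with the structure of the sub-adjacent Hopf algebra. -/
def SubAdj (_ : PostHopfAlgebra k A) : Type _ := A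

namespace SubAdj

variable (P : PostHopfAlgebra k A)

instance : AddCommGroup (SubAdj P) := inferInstanceAs (AddCommGroup A)

instance : Module k (SubAdj P) := inferInstanceAs (Module k A)

noncomputable instance : Coalgebra k (SubAdj P) := inferInstanceAs (Coalgebra k A)

instance [IsCocomm k A] : IsCocomm k (SubAdj P) := inferInstanceAs (IsCocomm k A)

variable [IsCocomm k A]

noncomputable instance : Ring (SubAdj P) where
  __ := (inferInstance : AddCommGroup (SubAdj P))
  mul x y := P.gl x y
  one := (1 : A)
  mul_assoc := PostHopfAlgebra.gl_assoc (P := P)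
  one_mul := PostHopfAlgebra.one_gl (P := P)
  mul_one := PostHopfAlgebra.gl_one (P := P)
  left_distrib x y z := map_add (P.gl x) y z
  right_distrib x y z := LinearMap.map_add₂ P.gl x y z
  zero_mul x := LinearMap.map_zero₂ P.gl x
  mul_zero x := map_zero (P.gl x)

noncomputable instance : Algebra k (SubAdj P) where
  algebraMap :=
    { toFun := fun c => algebraMap k A c
      map_one' := map_one (algebraMap k A)
      map_zero' := map_zero (algebraMap k A)
      map_add' := map_add (algebraMap k A)
      map_mul' := fun c d => (map_mul (algebraMap k A) c d).trans <|
        (Algebra.smul_def c _).symm.trans (PostHopfAlgebra.algebraMap_gl (P := P) c _).symm }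
  commutes' c x := (PostHopfAlgebra.algebraMap_gl (P := P) c x).trans
    (PostHopfAlgebra.gl_algebraMap (P := P) c x).symm
  smul_def' c x := (PostHopfAlgebra.algebraMap_gl (P := P) c x).symm

noncomputable instance : Bialgebra k (SubAdj P) :=
  Bialgebra.mk' k (SubAdj P) (Bialgebra.counit_one (R := k) (A := A))
    (fun {x y} => (PostHopfAlgebra.isCoalgBilin_gl (P := P)).counit_apply x y)
    (Bialgebra.comul_one (R := k) (A := A))
    (fun {x y} => by
      obtain ⟨n, u, v, h⟩ := exists_represents (comul (R := k) x)
      obtain ⟨n', u', v', h'⟩ := exists_represents (comul (R := k) y)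
      have := (PostHopfAlgebra.isCoalgBilin_gl (P := P)).comul_apply _ _ _ _ _ _ _ _ h h'
      refine Eq.trans this ?_
      rw [h, h', Finset.sum_mul_sum]
      simp only [Algebra.TensorProduct.tmul_mul_tmul]
      rfl)

noncomputable instance : HopfAlgebra k (SubAdj P) where
  antipode := P.subAdjacent.antipode
  mul_antipode_rTensor_comul := by
    ext x
    obtain ⟨n, u, v, h⟩ := exists_represents (comul (R := k) x)
    have := PostHopfAlgebra.sum_antipode_gl (P := P) h
    rw [LinearMap.comp_apply, LinearMap.comp_apply, h, map_sum, map_sum]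
    exact this
  mul_antipode_lTensor_comul := by
    ext x
    obtain ⟨n, u, v, h⟩ := exists_represents (comul (R := k) x)
    have := PostHopfAlgebra.sum_gl_antipode (P := P) h
    rw [LinearMap.comp_apply, LinearMap.comp_apply, h, map_sum, map_sum]
    exact this

end SubAdj

end SubAdjacent


/-! ### The post-Hopf algebroid `R ⊗ A` and its Grossman-Larson Hopf algebroid -/

section PostHopfAlgebroid

open Coalgebra

variable {k R A : Type*} [CommRing k] [CommRing R] [Algebra k R] [Ring A] [HopfAlgebra k A]

namespace PostHopfAlgebra

variable (P : PostHopfAlgebra k A) (act : A →ₗ[k] R →ₗ[k] R)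

/-- The product `fa ▷ gb = f (a₁ ⇀ g) (a₂ ▷ b)` on `R ⊗ A`. -/
noncomputable abbrev actTri : R ⊗[k] A →ₗ[R] (R ⊗[k] A →ₗ[k] R ⊗[k] A) :=
  twistMul act (TensorProduct.curry P.tri.toLinearMap)

variable {P act} {a : A} {n : ℕ} {u v : Fin n → A}

theorem twist_tri_tmul (h : Represents (comul (R := k) a) u v) (f : R) (b : A) :
    twist act (TensorProduct.curry P.tri.toLinearMap) a (f ⊗ₜ b) =
      ∑ i, act (u i) f ⊗ₜ[k] P.tri (v i ⊗ₜ b) :=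
  twist_tmul act _ h f b

theorem twist_tri_tmul_one (f : R) (a : A) :
    twist act (TensorProduct.curry P.tri.toLinearMap) a (f ⊗ₜ 1) = act a f ⊗ₜ 1 := by
  obtain ⟨n, u, v, h⟩ := exists_represents (comul (R := k) a)
  rw [twist_tri_tmul h]
  conv_rhs => rw [← h.sum_counit_smul']
  simp [tri_one, Algebra.algebraMap_eq_smul_one, TensorProduct.sum_tmul, TensorProduct.smul_tmul']

/-- For `z = gc`, the left side is `(a₁ ⇀ g)(a₂ ▷ b)(a₃ ▷ c)` and the right side is `(a₂ ⇀ g)(a₁ ▷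
b)(a₃ ▷ c)`; cocommutativity identifies them. The scalar of the first factor is treated separately
in `twist_tri_mul`, by `twist_smul`. -/
theorem twist_tri_one_tmul_mul [IsCocomm k A] (h : Represents (comul (R := k) a) u v)
    (b : A) (z : R ⊗[k] A) :
    twist act (TensorProduct.curry P.tri.toLinearMap) a ((1 ⊗ₜ b) * z) =
      ∑ i, ((1 : R) ⊗ₜ[k] P.tri (u i ⊗ₜ b)) *
        twist act (TensorProduct.curry P.tri.toLinearMap) (v i) z := by
  induction z with
  | zero => simp
  | add x y hx hy => simp only [mul_add, map_add, hx, hy, Finset.sum_add_distrib]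
  | tmul g c =>
    choose m p q hpq using fun i => exists_represents (comul (R := k) (u i))
    choose l r s hrs using fun i => exists_represents (comul (R := k) (v i))
    let F (x y z : A) : R ⊗[k] A := act x g ⊗ₜ[k] (P.tri (y ⊗ₜ b) * P.tri (z ⊗ₜ c))
    have h₁ (y z) : IsLinearMap k fun x => F x y z := by
      constructor <;> simp [F, TensorProduct.add_tmul, TensorProduct.smul_tmul']
    have h₂ (x z) : IsLinearMap k fun y => F x y z := by
      constructor <;> simp [F, TensorProduct.add_tmul, TensorProduct.tmul_add, add_mul,
        ← TensorProduct.smul_tmul']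
    have h₃ (x y) : IsLinearMap k fun z => F x y z := by
      constructor <;> simp [F, TensorProduct.add_tmul, TensorProduct.tmul_add, mul_add,
        ← TensorProduct.smul_tmul']
    have key := (h.sum_coassoc hpq hrs F h₁ h₂ h₃).symm.trans (h.sum_coassoc_swap hpq hrs F h₁ h₂ h₃)
    simp only [Algebra.TensorProduct.tmul_mul_tmul, one_mul, twist_tri_tmul h,
      fun i => twist_tri_tmul (P := P) (act := act) (hrs i), Finset.mul_sum,
      fun i => P.tri_mul _ b c _ _ _ (hrs i), TensorProduct.tmul_sum]
    exact key

theorem twist_tri_mul [IsCocomm k A] (hact : IsMeasuring act)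
    (h : Represents (comul (R := k) a) u v) (y z : R ⊗[k] A) :
    twist act (TensorProduct.curry P.tri.toLinearMap) a (y * z) =
      ∑ i, twist act (TensorProduct.curry P.tri.toLinearMap) (u i) y *
        twist act (TensorProduct.curry P.tri.toLinearMap) (v i) z := by
  induction y with
  | zero => simp
  | add x y hx hy => simp only [add_mul, map_add, hx, hy, Finset.sum_add_distrib]
  | tmul g b =>
    choose m p q hpq using fun i => exists_represents (comul (R := k) (u i))
    choose l r s hrs using fun i => exists_represents (comul (R := k) (v i))
    have := h.sum_coassoc hpq hrs (fun x y w => (act x g ⊗ₜ[k] P.tri (y ⊗ₜ b)) *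
        twist act (TensorProduct.curry P.tri.toLinearMap) w z)
      (fun _ _ => by
        constructor <;> simp [TensorProduct.add_tmul, ← TensorProduct.smul_tmul', add_mul])
      (fun _ _ => by
        constructor <;> simp [TensorProduct.add_tmul, TensorProduct.tmul_add, add_mul,
          ← TensorProduct.smul_tmul'])
      (fun _ _ => by constructor <;> simp [mul_add])
    have h2 : g ⊗ₜ[k] b * z = g • ((1 ⊗ₜ[k] b) * z) := by
      rw [← smul_mul_assoc, TensorProduct.smul_tmul', smul_eq_mul, mul_one]
    rw [h2, twist_smul hact h]
    simp only [fun i => twist_tri_tmul (P := P) (act := act) (hpq i), Finset.sum_mul, this,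
      fun i => twist_tri_one_tmul_mul (P := P) (act := act) (hrs i), Finset.smul_sum,
      ← smul_mul_assoc, TensorProduct.smul_tmul', smul_eq_mul, mul_one]

theorem actTri_mul [IsCocomm k A] (hact : IsMeasuring act) {x : R ⊗[k] A} {n : ℕ}
    {u v : Fin n → R ⊗[k] A} (h : Represents (comul (R := R) x) u v) (y z : R ⊗[k] A) :
    P.actTri act x (y * z) = ∑ i, P.actTri act (u i) y * P.actTri act (v i) z := by
  symm
  refine h.sum_balanced (fun s t => P.actTri act s y * P.actTri act t z)
    (fun _ _ _ => by simp [add_mul]) (fun _ _ _ => by simp [mul_add]) (fun g s t => by simp)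
    ((P.actTri act).flip (y * z)).toAddMonoidHom fun f a n u v h => ?_
  simp only [LinearMap.toAddMonoidHom_coe, LinearMap.flip_apply, twistMul_tmul, one_smul,
    twist_tri_mul hact h, Finset.smul_sum, smul_mul_assoc]

/-- On `fa` and `gb` the Grossman-Larson product is `f (a₂ ⇀ g) a₁ (a₃ ▷ b)`. By cocommutativity
this is `f (a₁ ⇀ g) a₂ (a₃ ▷ b) = f (a₁ ⇀ g)(a₂ *_▷ b)`. -/
theorem grossmanLarsonMul_actTri [IsCocomm k A] (x y : R ⊗[k] A) :
    grossmanLarsonMul (P.actTri act) x y = twistMul act P.gl x y := by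
  obtain ⟨n, u, v, h⟩ := exists_represents (comul (R := R) x)
  rw [grossmanLarsonMul_apply _ h]
  refine h.sum_balanced (fun s t => s * P.actTri act t y)
    (fun _ _ _ => by simp [add_mul]) (fun _ _ _ => by simp [mul_add]) (fun g s t => by simp)
    ((twistMul act P.gl).flip y).toAddMonoidHom fun f a n u v h => ?_
  simp only [LinearMap.toAddMonoidHom_coe, LinearMap.flip_apply, twistMul_tmul, one_smul]
  induction y with
  | zero => simp
  | add x y hx hy => simp only [mul_add, map_add, smul_add, hx, hy, Finset.sum_add_distrib]
  | tmul g b =>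
    choose m p q hpq using fun i => exists_represents (comul (R := k) (u i))
    choose l r s hrs using fun i => exists_represents (comul (R := k) (v i))
    let F (x y z : A) : R ⊗[k] A := (f * act x g) ⊗ₜ[k] (y * P.tri (z ⊗ₜ b))
    have h₁ (y z) : IsLinearMap k fun x => F x y z := by
      constructor <;> simp [F, mul_add, TensorProduct.add_tmul, TensorProduct.smul_tmul']
    have h₂ (x z) : IsLinearMap k fun y => F x y z := by
      constructor <;> simp [F, TensorProduct.tmul_add, add_mul]
    have h₃ (x y) : IsLinearMap k fun z => F x y z := by
      constructor <;> simp [F, TensorProduct.add_tmul, TensorProduct.tmul_add, mul_add,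
        ← TensorProduct.smul_tmul']
    have key := (h.sum_coassoc_swap hpq hrs F h₁ h₂ h₃).symm.trans (h.sum_coassoc hpq hrs F h₁ h₂ h₃)
    simp only [fun i => twist_tri_tmul (P := P) (act := act) (hrs i), Finset.mul_sum,
      Algebra.TensorProduct.tmul_mul_tmul, twist_tmul act P.gl h, Finset.smul_sum,
      fun i => gl_apply (P := P) (hrs i), TensorProduct.tmul_sum, TensorProduct.smul_tmul',
      smul_eq_mul]
    exact key

theorem actTri_actTri (hact : IsMeasuring act) [IsCocomm k A]
    (hmul : ∀ a b f, act (P.gl a b) f = act a (act b f)) (x y z : R ⊗[k] A) :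
    P.actTri act x (P.actTri act y z) = P.actTri act (twistMul act P.gl x y) z := by
  induction x with
  | zero => simp
  | add x x' hx hx' => simp only [map_add, LinearMap.add_apply, hx, hx']
  | tmul f a =>
  induction y with
  | zero => simp
  | add x x' hx hx' => simp only [map_add, LinearMap.add_apply, hx, hx']
  | tmul g b =>
    obtain ⟨n, u, v, h⟩ := exists_represents (comul (R := k) a)
    have key (a b : A) (y : R ⊗[k] A) := twist_apply_apply (m := P.gl)
      (φ := TensorProduct.curry P.tri.toLinearMap) isCoalgBilin_gl hmul tri_gl a b y
    simp only [twistMul_tmul, twist_smul hact h, map_smul, LinearMap.smul_apply]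
    simp only [twist_tmul act _ h, Finset.smul_sum, map_sum, LinearMap.sum_apply, twistMul_tmul,
      smul_smul, key]

/-- The weak post-Hopf algebroid structure on `R ⊗ A`. -/
noncomputable def weakPostHopfAlgebroid [IsCocomm k A] (P : PostHopfAlgebra k A)
    (hact : IsMeasuring act) (hone : ∀ f, act 1 f = f)
    (hmul : ∀ a b f, act (P.gl a b) f = act a (act b f)) :
    WeakPostHopfAlgebroid k R (R ⊗[k] A) where
  isCocomm := inferInstance
  tri := P.actTri act
  comul_tri _ _ _ _ _ _ _ _ h h' := comul_twistMul hact (isCoalgBilin_curry P.tri) h h'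
  tri_one x := by
    induction x with
    | zero => simp
    | add x x' hx hx' => simp only [map_add, LinearMap.add_apply, hx, hx']
    | tmul f a =>
      rw [Algebra.TensorProduct.one_def, twistMul_tmul, twist_tri_tmul_one, hact.act_one]
      simp [Algebra.smul_def, mul_comm]
  one_tri x := by
    rw [Algebra.TensorProduct.one_def, twistMul_tmul, one_smul]
    induction x with
    | zero => simp
    | add x x' hx hx' => simp only [map_add, hx, hx']
    | tmul f a =>
      rw [twist_tri_tmul represents_one]
      simp [hone, P.one_tri]
  counit_tri x y := by
    induction x with
    | zero => simp
    | add x x' hx hx' => simp only [map_add, LinearMap.add_apply, hx, hx']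
    | tmul f a =>
      rw [twistMul_tmul, twistMul_tmul, map_smul, counit_twist (isCoalgBilin_curry P.tri),
        Algebra.TensorProduct.algebraMap_apply, Algebra.TensorProduct.algebraMap_apply,
        twist_tri_tmul_one, TensorProduct.smul_tmul']
      rfl
  tri_mul _ y z _ _ _ h := actTri_mul hact h y z
  tri_tri x y z n u v h := by
    rw [actTri_actTri hact hmul, ← grossmanLarsonMul_actTri, grossmanLarsonMul_apply _ h]

section Action

variable [IsCocomm k A] (P : PostHopfAlgebra k A)

/-- The tuples `P.subAdjacent` and `ofHopfAlgebra k (SubAdj P)` agree definitionally. The results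
for a general `B` therefore apply with `B = SubAdj P`, on the same underlying coalgebra `A`. -/
theorem isHopfModuleAlgebra_subAdj (hact : P.subAdjacent.IsModuleAlgebra act) :
    IsHopfModuleAlgebra (B := SubAdj P) act :=
  IsHopfModuleAlgebra.of_ofHopfAlgebra (B := SubAdj P) hact

theorem grossmanLarsonMul_eq_smashProduct_mul :
    grossmanLarsonMul (P.actTri act) = (smashProduct P.subAdjacent act).mul :=
  LinearMap.ext₂ fun x y => (grossmanLarsonMul_actTri x y).trans
    (smashProduct_mul_apply (B := SubAdj P) (act := act) x y).symm

theorem isHopfAlgebroid_subAdjacent : P.subAdjacent.IsHopfAlgebroid :=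
  isHopfAlgebroid_ofHopfAlgebra (B := SubAdj P)

theorem isHopfAlgebroid_smashProduct_subAdjacent (hact : P.subAdjacent.IsModuleAlgebra act) :
    (smashProduct P.subAdjacent act).IsHopfAlgebroid :=
  isHopfAlgebroid_smashProduct (B := SubAdj P) (P.isHopfModuleAlgebra_subAdj hact)

/-- The post-Hopf algebroid structure on `R ⊗ A`. -/
noncomputable def postHopfAlgebroid (hact : P.subAdjacent.IsModuleAlgebra act) :
    PostHopfAlgebroid k R (R ⊗[k] A) where
  toWeakPostHopfAlgebroid := P.weakPostHopfAlgebroid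
    (P.isHopfModuleAlgebra_subAdj hact).toIsMeasuring hact.one_act hact.mul_act
  theta := (smashProduct P.subAdjacent act).antipode
  theta_bijective := (P.isHopfAlgebroid_smashProduct_subAdjacent hact).antipode_bijective
  theta_one := (P.isHopfAlgebroid_smashProduct_subAdjacent hact).antipode_one
  theta_mul x y := by
    change (smashProduct P.subAdjacent act).antipode (grossmanLarsonMul (P.actTri act) x y) =
      grossmanLarsonMul (P.actTri act) _ _
    rw [grossmanLarsonMul_eq_smashProduct_mul]
    exact (P.isHopfAlgebroid_smashProduct_subAdjacent hact).antipode_mul x y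
  comul_theta_and_mul_theta := by
    -- One section serves both identities, as the definition demands.
    refine ⟨freeSection k R A, isProjSection_freeSection, fun x => ?_, fun x => ?_⟩
    · exact proj_map_smashAntipode_freeSection (B := SubAdj P)
        (P.isHopfModuleAlgebra_subAdj hact) x
    · change TensorProduct.lift ((grossmanLarsonMul (P.actTri act)).compl₂ _) _ = _
      rw [grossmanLarsonMul_eq_smashProduct_mul]
      exact lift_smashAntipode_freeSection (B := SubAdj P) (P.isHopfModuleAlgebra_subAdj hact) x
  theta_mul_self x n u v h := by
    change ∑ i, grossmanLarsonMul (P.actTri act) _ _ = _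
    rw [grossmanLarsonMul_eq_smashProduct_mul]
    have := sum_smashAntipode_smashMul (B := SubAdj P) (P.isHopfModuleAlgebra_subAdj hact) h
    exact (Finset.sum_congr rfl fun i _ =>
      smashProduct_mul_apply (B := SubAdj P) (act := act) _ _).trans this

theorem grossmanLarson_postHopfAlgebroid (hact : P.subAdjacent.IsModuleAlgebra act) :
    (P.postHopfAlgebroid hact).grossmanLarson = smashProduct P.subAdjacent act := by
  refine HopfAlgebroidData.ext (P.grossmanLarsonMul_eq_smashProduct_mul) rfl rfl ?_ ?_ rfl
  · exact (LinearMap.ext (smashProduct_comul_apply (B := SubAdj P) (act := act))).symm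
  · exact (LinearMap.ext (smashProduct_counit_apply (B := SubAdj P) (act := act))).symm

end Action

end PostHopfAlgebra

end PostHopfAlgebroid

end PostHopf

theorem mainTheorem3 {k R A : Type*} [Field k] [CommRing R] [Algebra k R] [Ring A]
    [HopfAlgebra k A] [Coalgebra.IsCocomm k A] (P : PostHopf.PostHopfAlgebra k A)
    (act : A →ₗ[k] R →ₗ[k] R) (hact : P.subAdjacent.IsModuleAlgebra act) :
    P.subAdjacent.IsHopfAlgebroid ∧
    ∃ Q : PostHopf.PostHopfAlgebroid k R (R ⊗[k] A),
      (∀ (f g : R) (a b : A) (n : ℕ) (u v : Fin n → A),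
        PostHopf.Represents (Coalgebra.comul (R := k) a) u v →
        Q.tri (f ⊗ₜ a) (g ⊗ₜ b) = ∑ i, (f * act (u i) g) ⊗ₜ[k] P.tri (v i ⊗ₜ b)) ∧
      (∀ (f : R) (a : A) (n : ℕ) (u v : Fin n → A),
        PostHopf.Represents (Coalgebra.comul (R := k) a) u v →
        Q.theta (f ⊗ₜ a) =
          ∑ i, act (P.subAdjacent.antipode (u i)) f ⊗ₜ[k] P.subAdjacent.antipode (v i)) ∧
      (∀ (f g : R) (a : A) (n : ℕ) (u v : Fin n → A),
        PostHopf.Represents (Coalgebra.comul (R := k) a) u v →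
        Coalgebra.comul (R := R) (Q.theta ((f * g) ⊗ₜ a)) =
          ∑ i, Q.theta (f ⊗ₜ u i) ⊗ₜ[R] Q.theta (g ⊗ₜ v i) ∧
        ∑ i, Q.grossmanLarson.mul (f ⊗ₜ u i) (Q.theta (g ⊗ₜ v i)) =
          (f * g * algebraMap k R (Coalgebra.counit a)) ⊗ₜ[k] (1 : A)) ∧
      Q.grossmanLarson.IsHopfAlgebroid ∧
      Q.grossmanLarson = PostHopf.smashProduct P.subAdjacent act := by
  have hact' := P.isHopfModuleAlgebra_subAdj hact
  refine ⟨P.isHopfAlgebroid_subAdjacent, P.postHopfAlgebroid hact, ?_, ?_, ?_, ?_,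
    P.grossmanLarson_postHopfAlgebroid hact⟩
  · intro f g a b n u v h
    refine (congrArg (f • ·) (PostHopf.PostHopfAlgebra.twist_tri_tmul (P := P) h g b)).trans ?_
    simp only [Finset.smul_sum, TensorProduct.smul_tmul', smul_eq_mul]
  · intro f a n u v h
    exact PostHopf.smashProduct_antipode P.subAdjacent act h f
  · intro f g a n u v h
    refine ⟨PostHopf.comul_smashAntipode (B := PostHopf.SubAdj P) hact' h f g, ?_⟩
    rw [P.grossmanLarson_postHopfAlgebroid hact]
    have := PostHopf.sum_smashMul_smashAntipode (B := PostHopf.SubAdj P) hact' h f g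
    exact (Finset.sum_congr rfl fun i _ =>
      PostHopf.smashProduct_mul_apply (B := PostHopf.SubAdj P) (act := act) _ _).trans this
  · rw [P.grossmanLarson_postHopfAlgebroid hact]
    exact P.isHopfAlgebroid_smashProduct_subAdjacent hact
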